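/- **Setting.** Let $d\ge 1$, let $F:\mathbb{R}^d\to\mathbb{R}$ be differentiable and bounded below, and suppose that $F(y)-F(x)=\int_0^1\langle\nabla F(x+t(y-x)),y-x\rangle\,dt$ for all $x,y$. Let $G,\sigma\in(0,\infty)^d$ and let $\mathrm{SG}:\mathbb{R}^d\times\mathcal Z\to\mathbb{R}^d$ be a (measurable) stochastic gradient oracle with randomness $r\sim\nu$ on $\mathcal Z$ such that for all $x\in\mathbb{R}^d$ and all $i\in\{1,\dots,d\}$ $$|\partial_iF(x)|\le G_i,\qquad \mathbb{E}_r[\mathrm{SG}(x,r)[i]]=\partial_iF(x),\qquad \mathbb{E}_r\big|\mathrm{SG}(x,r)[i]-\partial_iF(x)\big|^2\le\sigma_i^2 .$$ For $\lambda>0$ put $$\|\nabla F(x)\|_1^{[\lambda]}=\inf_{p}\Big\{\big\|\mathbb{E}_{y\sim p}\nabla F(y)\big\|_1+\lambda\,\mathbb{E}_{y\sim p}\|y-x\|_2^2\Big\},$$ the infimum being over all probability measures $p$ on $\mathbb{R}^d$ with $\mathbb{E}_{y\sim p}[y]=x$. A point $x$ is a $(\lambda,\delta)$-$L_1$-stationary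 point of $F$ if $\|\nabla F(x)\|_1^{[\lambda]}\le\delta$. **Algorithm.** Given $x_0\in\mathbb{R}^d$, $\beta\in(0,1)$, $D>0$ and $T\in\mathbb{N}$, for $t=1,\dots,T$: let $x_t=x_{t-1}+\alpha_tz_t$ and $g_t=\mathrm{SG}(x_t,r_t)$, where $\alpha_1,r_1,\alpha_2,r_2,\dots$ are independent, $\alpha_t\sim\mathrm{Exp}(1)$, $r_t\sim\nu$, and the increment is that of coordinate-wise clipped-Adam with $\beta_1=\beta$, $\beta_2=\beta^2$: for $i=1,\dots,d$, $$z_t[i]=-\mathrm{clip}_D\!\left(D\,\frac{\sum_{s=1}^{t-1}\beta_1^{t-1-s}g_s[i]}{\sqrt{\sum_{s=1}^{t-1}\beta_2^{t-1-s}g_s[i]^2}}\right),\qquad \mathrm{clip}_D(x)=x\min(D/|x|,1),$$ with $z_t[i]=0$ if the denominator is zero. The EMA iterates are $\bar x_t=\frac{\beta-\beta^t}{1-\beta^t}\bar x_{t-1}+\frac{1-\beta}{1-\beta^t}x_t$, i.e. $\bar x_t=\frac{1-\beta}{1-\beta^t}\sum_{s=1}^t\beta^{t-s}x_s$. **Theorem.**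 Let $\lambda>0$, $C>0$, $0<\varepsilon<10C$, $\Delta=F(x_0)-\inf F$, and run the algorithm with $$\beta=1-\Big(\frac{\varepsilon}{10C}\Big)^2,\qquad D=\frac{(1-\beta)\varepsilon^{1/2}}{4d^{1/2}\lambda^{1/2}},\qquad T=\left\lceil\frac1{1-\beta}\max\Big\{\frac{4\Delta d^{1/2}\lambda^{1/2}}{\varepsilon^{3/2}},\frac{12C}{\varepsilon}\Big\}\right\rceil .$$ Then, for every $1\le t\le T$, $\|\nabla F(\bar x_t)\|_1^{[\lambda]}$ is integrable, and $$\frac1T\sum_{t=1}^T\mathbb{E}\,\|\nabla F(\bar x_t)\|_1^{[\lambda]}\;\le\;\Big(2+\frac{\|G+\sigma\|_1}{C}\Big)\varepsilon .$$ In other words, an EMA iterate chosen uniformly at random is, in expectation, a $\big(\lambda,(2+\|G+\sigma\|_1/C)\varepsilon\big)$-$L_1$-stationary point of $F$. -/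

import Mathlib

open MeasureTheory ProbabilityTheory

noncomputable section

namespace ClippedAdam

/-- `ℝ^d` with the Euclidean norm. -/
abbrev E (d : ℕ) : Type := EuclideanSpace ℝ (Fin d)

/-- The `L₁` norm of a vector, given by its coordinates. -/
def l1Norm {d : ℕ} (v : Fin d → ℝ) : ℝ := ∑ i, |v i|

/-- The admissible laws in the definition of stationarity at `x`: probability measures on `ℝ^d`
with mean `x`, for which the mean of `∇F` exists and the second moment is finite (a law with
infinite second moment has objective value `+∞`, so it does not affect the infimum). -/
structure IsAdmissible {d : ℕ} (F : E d → ℝ) (x : E d) (p : Measure (E d)) : Prop where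
  isProb : IsProbabilityMeasure p
  memLp : MemLp (fun y : E d => y) 2 p
  mean : ∫ y, y ∂p = x
  integrable_gradient : Integrable (fun y => gradient F y) p

/-- The regularized gradient norm: the infimum, over all laws `p` with mean `x`, of
`‖𝔼_{y∼p} ∇F(y)‖₁ + lam * 𝔼_{y∼p} ‖y - x‖₂²`. The point `x` is a `(lam, eps)`-`L₁`-stationary
point of `F` if this quantity is at most `eps`. -/
def regNorm₁ {d : ℕ} (lam : ℝ) (F : E d → ℝ) (x : E d) : ℝ :=
  sInf {c : ℝ | ∃ p : Measure (E d), IsAdmissible F x p ∧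
    c = l1Norm (fun i => (∫ y, gradient F y ∂p) i) + lam * ∫ y, ‖y - x‖ ^ 2 ∂p}

/-- The standing assumptions on the loss `F`, the stochastic gradient oracle `stoGrad` and the
law `ν` of its randomness, with coordinate-wise Lipschitz constants `G` and standard
deviations `σ`. -/
structure CoordinateAssumption {d : ℕ} {Z : Type*} [MeasurableSpace Z]
    (F : E d → ℝ) (stoGrad : E d → Z → E d) (ν : Measure Z) (G σ : Fin d → ℝ) : Prop where
  differentiable : Differentiable ℝ F
  bddBelow : BddBelow (Set.range F)
  wellBehaved : ∀ x y : E d,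
    F y - F x = ∫ t in (0 : ℝ)..1, inner ℝ (gradient F (x + t • (y - x))) (y - x)
  G_pos : ∀ i, 0 < G i
  σ_pos : ∀ i, 0 < σ i
  lipschitz : ∀ x i, |gradient F x i| ≤ G i
  measurable_stoGrad : Measurable (fun q : E d × Z => stoGrad q.1 q.2)
  memLp_stoGrad : ∀ x i, MemLp (fun r => stoGrad x r i) 2 ν
  unbiased : ∀ x i, ∫ r, stoGrad x r i ∂ν = gradient F x i
  variance : ∀ x i, ∫ r, |stoGrad x r i - gradient F x i| ^ 2 ∂ν ≤ σ i ^ 2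

/-- The random inputs of the algorithm: the step multipliers `α t` are exponential with mean `1`,
the oracle seeds `r t` have law `ν`, and all of them are independent. -/
structure IsSampling {Ω Z : Type*} [MeasurableSpace Ω] [MeasurableSpace Z]
    (P : Measure Ω) (ν : Measure Z) (α : ℕ → Ω → ℝ) (r : ℕ → Ω → Z) : Prop where
  measurable_α : ∀ t, Measurable (α t)
  measurable_r : ∀ t, Measurable (r t)
  law : ∀ t, P.map (fun ω => (α t ω, r t ω)) = (expMeasure 1).prod ν
  indep : iIndepFun (fun t ω => (α t ω, r t ω)) P

/-- Scalar clipping `clip_D(x) = x * min (D / |x|) 1`. -/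
def clip (D x : ℝ) : ℝ := x * min (D / |x|) 1

/-- Coordinate-wise clipped-Adam: the increment `z_{t+1}` computed from the stochastic gradients
`g 1, …, g t`. If the denominator of a coordinate is zero, that coordinate of the increment is
`0` (this is what Lean's `x / 0 = 0` gives). -/
def clippedAdam {d : ℕ} (β₁ β₂ D : ℝ) (g : ℕ → E d) (t : ℕ) : E d :=
  WithLp.toLp 2 fun i =>
    -clip D (D * ((∑ s ∈ Finset.Icc 1 t, β₁ ^ (t - s) * g s i) /
      Real.sqrt (∑ s ∈ Finset.Icc 1 t, β₂ ^ (t - s) * g s i ^ 2)))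

/-- The discounted-to-nonconvex conversion along a fixed realization `α`, `r` of the randomness.
The learner `A` maps the gradients observed so far (`A g t` is given `g 1, …, g t`) to the next
increment `z_{t+1}`. The value at `t` is the pair of the iterate `x_t` and the record of
`g_1, …, g_t` (with zeros at all other indices). -/
def conversion {d : ℕ} {Z : Type*} (A : (ℕ → E d) → ℕ → E d) (stoGrad : E d → Z → E d)
    (x₀ : E d) (α : ℕ → ℝ) (r : ℕ → Z) : ℕ → E d × (ℕ → E d)
  | 0 => (x₀, fun _ => 0)
  | t + 1 =>
    let st := conversion A stoGrad x₀ α r t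
    let x := st.1 + α (t + 1) • A st.2 t
    (x, Function.update st.2 (t + 1) (stoGrad x (r (t + 1))))

/-- The exponential moving average `x̄_t` of a sequence `x` (the value at `0` is irrelevant, since
its coefficient at time `1` vanishes). -/
def ema {d : ℕ} (β : ℝ) (x : ℕ → E d) : ℕ → E d
  | 0 => x 0
  | t + 1 => ((β - β ^ (t + 1)) / (1 - β ^ (t + 1))) • ema β x t +
      ((1 - β) / (1 - β ^ (t + 1))) • x (t + 1)

/-- The EMA iterate `x̄_t` of the conversion run with coordinate-wise clipped-Adam,
`β₁ = β` and `β₂ = β²`. -/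
def adamEMA {d : ℕ} {Z : Type*} (β D : ℝ) (stoGrad : E d → Z → E d) (x₀ : E d)
    (α : ℕ → ℝ) (r : ℕ → Z) (t : ℕ) : E d :=
  ema β (fun s => (conversion (clippedAdam β (β ^ 2) D) stoGrad x₀ α r s).1) t

end ClippedAdam

end

set_option linter.unusedSectionVars false

noncomputable section

namespace ClippedAdam

/-! The bound combines two mechanisms. If `a` is exponential with mean 1 and independent of `(x,
z)`, integration by parts gives `E[F(x + a z) - F(x)] = E⟨∇F(x + a z), z⟩`, an exact identity
without smoothness (`integral_exponential_step`). So the expected decrease of `F` is minus the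
linear loss of the increments `z_t`, and an online learner with small regret must either decrease
`F` or see a small discounted gradient sum.

Coordinate-wise clipped-Adam is such a learner: it is discounted follow-the-regularized-leader on
`[-D, D]` with regularizer `q u² / (2D)`, where `q` is the discounted root-sum-of-squares of the
gradients. Comparison with the best of `u = ±D` yields `D |∑ β^(t-s) g_s| ≤ (7/2) D q_t - ∑ β^(t-s)
g_s z_s` (`abs_discountedSum_le_of_clip`). In expectation the noise sum and `q_t` are of order
`1/√(1-β)` (`discounted_noise`, `discounted_observed`), and the linear losses become discounted
decrements of `E F(x_s)`, whose sum over `t` telescopes to at most `Δ/(1-β)`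
(`sum_discountedSum_decrements_le`).

The EMA iterate is the mean of the law with weights proportional to `β^(t-s)` on `x_s`, so this law
is a competitor in the infimum (`regNorm₁_ema_le`). Its mean gradient is the normalized discounted
gradient sum, and its variance is of order `d D² / (1-β)²` because increments are at most `D` per
coordinate. The parameters balance these terms. -/

/-- The discounted sum `∑_{s=1}^t β^(t-s) c_s`. -/
def discountedSum {V : Type*} [AddCommGroup V] [Module ℝ V] (β : ℝ) (c : ℕ → V) (t : ℕ) : V :=
  ∑ s ∈ Finset.Icc 1 t, β ^ (t - s) • c s

/-! ### Algebra of discounted sums. -/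

section DiscountedSum

variable {V : Type*} [AddCommGroup V] [Module ℝ V]

@[simp] lemma discountedSum_zero (β : ℝ) (c : ℕ → V) : discountedSum β c 0 = 0 := by
  simp [discountedSum]

lemma discountedSum_succ (β : ℝ) (c : ℕ → V) (t : ℕ) :
    discountedSum β c (t + 1) = β • discountedSum β c t + c (t + 1) := by
  unfold discountedSum
  rw [Finset.sum_Icc_succ_top (by omega), Finset.smul_sum]
  congr 1
  · refine Finset.sum_congr rfl fun s hs => ?_
    rw [Finset.mem_Icc] at hs
    rw [smul_smul, ← pow_succ', show t + 1 - s = t - s + 1 by omega]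
  · simp

lemma discountedSum_congr {β : ℝ} {c c' : ℕ → V} {t : ℕ}
    (h : ∀ s, 1 ≤ s → s ≤ t → c s = c' s) : discountedSum β c t = discountedSum β c' t := by
  refine Finset.sum_congr rfl fun s hs => ?_
  rw [Finset.mem_Icc] at hs
  rw [h s hs.1 hs.2]

lemma discountedSum_sub (β : ℝ) (c c' : ℕ → V) (t : ℕ) :
    discountedSum β (fun s => c s - c' s) t = discountedSum β c t - discountedSum β c' t := by
  simp [discountedSum, smul_sub, Finset.sum_sub_distrib]

lemma discountedSum_sum {ι : Type*} (I : Finset ι) (β : ℝ) (c : ι → ℕ → V) (t : ℕ) :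
    discountedSum β (fun s => ∑ i ∈ I, c i s) t = ∑ i ∈ I, discountedSum β (c i) t := by
  simp only [discountedSum, Finset.smul_sum]
  exact Finset.sum_comm

lemma discountedSum_const_one (β : ℝ) (t : ℕ) :
    (1 - β) * discountedSum β (fun _ => (1 : ℝ)) t = 1 - β ^ t := by
  induction t with
  | zero => simp
  | succ t ih =>
    rw [discountedSum_succ, smul_eq_mul, pow_succ']
    linear_combination β * ih

lemma discountedSum_mono {β : ℝ} (hβ : 0 ≤ β) {c c' : ℕ → ℝ} {t : ℕ}
    (h : ∀ s, 1 ≤ s → s ≤ t → c s ≤ c' s) : discountedSum β c t ≤ discountedSum β c' t := by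
  refine Finset.sum_le_sum fun s hs => ?_
  rw [Finset.mem_Icc] at hs
  exact mul_le_mul_of_nonneg_left (h s hs.1 hs.2) (pow_nonneg hβ _)

lemma abs_discountedSum_le {β : ℝ} (hβ : 0 ≤ β) (c : ℕ → ℝ) (t : ℕ) :
    |discountedSum β c t| ≤ discountedSum β (fun s => |c s|) t := by
  refine (Finset.abs_sum_le_sum_abs _ _).trans (le_of_eq ?_)
  refine Finset.sum_congr rfl fun s _ => ?_
  rw [smul_eq_mul, smul_eq_mul, abs_mul, abs_of_nonneg (pow_nonneg hβ _)]

/-- With `B_t` the inner discounted sum, `(1-β) ∑ B_t` equals `a_0 - (β B_T + a_T)` exactly. The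
remainder is nonnegative since `B_(t+1) + a_(t+1) = β B_t + a_t`, and `β B + a` is a convex
combination of `B + a` and `a`. -/
lemma sum_discountedSum_decrements_le {β : ℝ} (hβ₀ : 0 ≤ β) (hβ₁ : β ≤ 1) {a : ℕ → ℝ}
    (ha : ∀ t, 0 ≤ a t) (T : ℕ) :
    (1 - β) * ∑ t ∈ Finset.Icc 1 T, discountedSum β (fun s => a (s - 1) - a s) t ≤ a 0 := by
  set B := discountedSum β (fun s => a (s - 1) - a s) with hB
  have hsucc : ∀ t, B (t + 1) = β * B t + a t - a (t + 1) := by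
    intro t
    rw [hB, discountedSum_succ]
    simp
    ring
  have h0 : B 0 = 0 := by simp [hB]
  have hnn : ∀ t, 0 ≤ B t + a t ∧ 0 ≤ β * B t + a t := by
    intro t
    induction t with
    | zero => simp [h0, ha 0]
    | succ t ih =>
      have h1 : 0 ≤ B (t + 1) + a (t + 1) := by rw [hsucc]; linarith [ih.2]
      refine ⟨h1, ?_⟩
      nlinarith [mul_nonneg hβ₀ h1, mul_nonneg (sub_nonneg.2 hβ₁) (ha (t + 1))]
  have key : ∀ T, (1 - β) * ∑ t ∈ Finset.Icc 1 T, B t + β * B T + a T = a 0 := by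
    intro T
    induction T with
    | zero => simp [h0]
    | succ T ih =>
      rw [Finset.sum_Icc_succ_top (by omega)]
      linear_combination ih + hsucc T
  linarith [key T, (hnn T).2]

lemma sum_Icc_comp_sub {M : Type*} [AddCommMonoid M] (f : ℕ → M) (t : ℕ) :
    ∑ s ∈ Finset.Icc 1 t, f (t - s) = ∑ k ∈ Finset.range t, f k := by
  refine Finset.sum_bij' (fun s _ => t - s) (fun k _ => t - k) ?_ ?_ ?_ ?_ ?_ <;>
    simp <;> omega

/-- Bound `k²` by `k(k+1)` and sum by parts twice; the boundary terms are nonnegative. The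
unnormalized weight stays on the right so that it cancels the EMA normalization, uniformly in `t`.
-/
lemma discountedSum_sq_delay_le {β : ℝ} (hβ₀ : 0 ≤ β) (hβ₁ : β ≤ 1) (t : ℕ) :
    (1 - β) ^ 2 * discountedSum β (fun s => ((t - s : ℕ) : ℝ) ^ 2) t ≤
      2 * discountedSum β (fun _ => (1 : ℝ)) t := by
  unfold discountedSum
  simp only [smul_eq_mul]
  rw [sum_Icc_comp_sub (fun k => β ^ k * (k : ℝ) ^ 2), sum_Icc_comp_sub (fun k => β ^ k * 1)]
  have h1 : ∀ t : ℕ, (1 - β) * ∑ k ∈ Finset.range (t + 1), β ^ k * (k : ℝ) + β ^ (t + 1) * t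
      = ∑ k ∈ Finset.range (t + 1), β ^ k * 1 - 1 := by
    intro t
    induction t with
    | zero => simp
    | succ t ih =>
      rw [Finset.sum_range_succ, Finset.sum_range_succ _ (t + 1)]
      push_cast
      linear_combination ih
  have h2 : ∀ t : ℕ, (1 - β) * ∑ k ∈ Finset.range (t + 1), β ^ k * ((k : ℝ) * (k + 1))
      + β ^ (t + 1) * (t * (t + 1)) = 2 * ∑ k ∈ Finset.range (t + 1), β ^ k * (k : ℝ) := by
    intro t
    induction t with
    | zero => simp
    | succ t ih =>
      rw [Finset.sum_range_succ, Finset.sum_range_succ _ (t + 1)]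
      push_cast
      linear_combination ih
  have h3 : ∀ t : ℕ, ∑ k ∈ Finset.range t, β ^ k * (k : ℝ) ^ 2 ≤
      ∑ k ∈ Finset.range t, β ^ k * ((k : ℝ) * (k + 1)) := by
    intro t
    refine Finset.sum_le_sum fun k _ => mul_le_mul_of_nonneg_left ?_ (pow_nonneg hβ₀ _)
    have : (0 : ℝ) ≤ k := Nat.cast_nonneg k
    nlinarith
  cases t with
  | zero => simp
  | succ t =>
    have e1 := h1 t
    have e2 := h2 t
    have e3 := h3 (t + 1)
    have hb : 0 ≤ 1 - β := sub_nonneg.2 hβ₁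
    have p1 : 0 ≤ β ^ (t + 1) * (t : ℝ) := by positivity
    have p2 : 0 ≤ β ^ (t + 1) * ((t : ℝ) * (t + 1)) := by positivity
    have e4 := mul_le_mul_of_nonneg_left e3 (pow_nonneg hb 2)
    nlinarith [mul_nonneg hb p2]

end DiscountedSum

/-! ### Clipped-Adam as discounted follow-the-regularized-leader in one coordinate. -/

section Regret

lemma clip_of_abs_le {D x : ℝ} (h : |x| ≤ D) : clip D x = x := by
  unfold clip
  rcases eq_or_ne x 0 with rfl | hx
  · simp
  · rw [min_eq_right, mul_one]
    rwa [le_div_iff₀ (abs_pos.2 hx), one_mul]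

lemma clip_of_le {D x : ℝ} (hD : 0 < D) (h : D ≤ x) : clip D x = D := by
  have hx : 0 < x := hD.trans_le h
  unfold clip
  rw [abs_of_pos hx, min_eq_left ((div_le_one hx).2 h)]
  field_simp

lemma clip_neg (D x : ℝ) : clip D (-x) = -clip D x := by simp [clip]

lemma clip_of_le_neg {D x : ℝ} (hD : 0 < D) (h : x ≤ -D) : clip D x = -D := by
  have := clip_of_le hD (le_neg_of_le_neg h)
  rw [clip_neg] at this
  linarith

lemma abs_clip_le {D : ℝ} (hD : 0 < D) (x : ℝ) : |clip D x| ≤ D := by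
  rcases le_total |x| D with h | h
  · rwa [clip_of_abs_le h]
  · rcases le_abs.1 h with h | h
    · rw [clip_of_le hD h, abs_of_pos hD]
    · rw [clip_of_le_neg hD (le_neg_of_le_neg h), abs_neg, abs_of_pos hD]

/-- First-order optimality of the clipped step for the regularized linear loss on `[-D, D]`. -/
lemma clip_step_optimal {D S q u z : ℝ} (hD : 0 < D) (hq : 0 ≤ q) (hS : q = 0 → S = 0)
    (hu : |u| ≤ D) (hz : z = -clip D (D * (S / q))) :
    0 ≤ (S + q * z / D) * (u - z) := by
  obtain ⟨hu1, hu2⟩ := abs_le.1 hu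
  rcases hq.eq_or_lt with h0 | hq
  · rw [hS h0.symm, ← h0]; simp
  rcases le_or_gt S q with h1 | h1
  · rcases le_or_gt (-q) S with h2 | h2
    · have hle : |D * (S / q)| ≤ D := by
        rw [abs_mul, abs_of_pos hD, abs_div, abs_of_pos hq]
        exact mul_le_of_le_one_right hD.le ((div_le_one hq).2 (abs_le.2 ⟨h2, h1⟩))
      rw [clip_of_abs_le hle] at hz
      have : S + q * z / D = 0 := by rw [hz]; field_simp; ring
      rw [this, zero_mul]
    · have hle : D * (S / q) ≤ -D := by
        have : S / q ≤ -1 := by rw [div_le_iff₀ hq]; linarith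
        nlinarith
      rw [clip_of_le_neg hD hle, neg_neg] at hz
      have : S + q * z / D = S + q := by rw [hz]; field_simp
      rw [this, hz]
      exact mul_nonneg_of_nonpos_of_nonpos (by linarith) (by linarith)
  · have hle : D ≤ D * (S / q) := by
      have : 1 ≤ S / q := by rw [le_div_iff₀ hq]; linarith
      nlinarith
    rw [clip_of_le hD hle] at hz
    have : S + q * z / D = S - q := by rw [hz]; field_simp; ring
    rw [this, hz]
    exact mul_nonneg (by linarith) (by linarith)

/-- The one-step stability bound of follow-the-regularized-leader with regularizer
`q u² / (2 D)`. -/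
lemma stability_step {D q v w : ℝ} (hD : 0 < D) (hq : 0 ≤ q) (hw : |w| ≤ 2 * D) :
    v * w - q / (2 * D) * w ^ 2 ≤ 3 * D * (√(q ^ 2 + v ^ 2) - q) := by
  set R := √(q ^ 2 + v ^ 2) with hR
  have hR2 : R ^ 2 = q ^ 2 + v ^ 2 := Real.sq_sqrt (by positivity)
  have hR0 : 0 ≤ R := Real.sqrt_nonneg _
  have hRq : q ≤ R := by nlinarith
  have hRv : R ≤ q + |v| := by
    refine abs_le_of_sq_le_sq' ?_ (by positivity) |>.2
    nlinarith [sq_abs v, abs_nonneg v, mul_nonneg hq (abs_nonneg v)]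
  set c := v * w - q / (2 * D) * w ^ 2 with hc
  have hqw : 0 ≤ q / (2 * D) * w ^ 2 := by positivity
  have hc1 : c ≤ 2 * D * |v| := by
    have : v * w ≤ |v| * |w| := by rw [← abs_mul]; exact le_abs_self _
    nlinarith [abs_nonneg v]
  have hc2 : 2 * q * c ≤ D * v ^ 2 := by
    have h2 : 2 * q * c = D * v ^ 2 - (D * v - q * w) ^ 2 / D := by
      rw [hc]; field_simp; ring
    rw [h2]
    have : 0 ≤ (D * v - q * w) ^ 2 / D := by positivity
    linarith
  rcases le_or_gt c 0 with h0 | h0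
  · exact h0.trans (by have : 0 ≤ R - q := by linarith
                       positivity)
  -- Since `R ≤ q + |v|`, `c (R + q) ≤ 2qc + c|v| ≤ D v² + 2D v²`, and `v² = (R - q)(R + q)`; this
  -- is the source of the constant 3.
  have hmain : c * (R + q) ≤ 3 * D * (R - q) * (R + q) := by
    have e : 3 * D * (R - q) * (R + q) = 3 * D * v ^ 2 := by linear_combination 3 * D * hR2
    rw [e]
    nlinarith [abs_nonneg v, sq_abs v, mul_le_mul_of_nonneg_left hRv h0.le,
      mul_le_mul_of_nonneg_left hc1 (abs_nonneg v)]
  rcases (add_nonneg hR0 hq).eq_or_lt with h | h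
  · have hq' : q = 0 := by linarith
    have hR' : R = 0 := by linarith
    have hv : v = 0 := by
      have : v ^ 2 = 0 := by rw [hq', hR'] at hR2; linarith
      exact pow_eq_zero_iff (two_ne_zero) |>.1 this
    rw [hv, abs_zero] at hc1
    linarith
  · exact le_of_mul_le_mul_right hmain h

/-- The discounted root-sum-of-squares `√(∑_{s=1}^t β^(2(t-s)) g_s²)`. -/
def discountedRss (β : ℝ) (g : ℕ → ℝ) (t : ℕ) : ℝ :=
  √(discountedSum (β ^ 2) (fun s => g s ^ 2) t)

lemma discountedSum_sq_nonneg (β : ℝ) (g : ℕ → ℝ) (t : ℕ) :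
    0 ≤ discountedSum (β ^ 2) (fun s => g s ^ 2) t :=
  Finset.sum_nonneg fun _ _ => by rw [smul_eq_mul]; positivity

lemma discountedRss_nonneg (β : ℝ) (g : ℕ → ℝ) (t : ℕ) : 0 ≤ discountedRss β g t :=
  Real.sqrt_nonneg _

lemma discountedRss_sq (β : ℝ) (g : ℕ → ℝ) (t : ℕ) :
    discountedRss β g t ^ 2 = discountedSum (β ^ 2) (fun s => g s ^ 2) t :=
  Real.sq_sqrt (discountedSum_sq_nonneg β g t)

lemma discountedRss_succ (β : ℝ) (g : ℕ → ℝ) (t : ℕ) :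
    discountedRss β g (t + 1) = √((β * discountedRss β g t) ^ 2 + g (t + 1) ^ 2) := by
  rw [mul_pow, discountedRss_sq, discountedRss, discountedSum_succ, smul_eq_mul]

/-- A zero denominator forces a zero numerator, so the convention `z = 0` there is still a
minimizing step. -/
lemma discountedSum_eq_zero_of_discountedRss {β : ℝ} (hβ : 0 < β) {g : ℕ → ℝ} {t : ℕ}
    (h : discountedRss β g t = 0) : discountedSum β g t = 0 := by
  have h0 : discountedSum (β ^ 2) (fun s => g s ^ 2) t = 0 := by
    rw [← discountedRss_sq, h]; simp
  unfold discountedSum at h0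
  rw [Finset.sum_eq_zero_iff_of_nonneg
    (fun s _ => by rw [smul_eq_mul]; positivity)] at h0
  refine Finset.sum_eq_zero fun s hs => ?_
  have := h0 s hs
  rw [smul_eq_mul] at this
  have hg : g s = 0 := by
    rcases mul_eq_zero.1 this with h | h
    · exact absurd h (by positivity)
    · exact pow_eq_zero_iff (two_ne_zero) |>.1 h
  simp [hg]

/-- Induction with the comparator at time `t` taken to be the next play `z_(t+1)`; optimality of
that play then passes to `u` with a gain `q (z - u)² / (2D)`, which `stability_step` spends on the
new loss. As `β₂ = β²`, the regularizer is discounted by the same factor `β` as the losses, so the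
stability costs `3D (q_(t+1) - β q_t)` telescope. -/
lemma discounted_regret {β D : ℝ} (hβ : 0 < β) (hD : 0 < D) (g z : ℕ → ℝ)
    (hz : ∀ t, z (t + 1) = -clip D (D * (discountedSum β g t / discountedRss β g t)))
    (t : ℕ) : ∀ u : ℝ, |u| ≤ D →
    discountedSum β (fun s => g s * z s) t ≤
      discountedSum β g t * u + discountedRss β g t / (2 * D) * u ^ 2
        + 3 * D * discountedRss β g t := by
  induction t with
  | zero => intro u _; simp [discountedRss]
  | succ t ih =>
    intro u hu
    have hzD : |z (t + 1)| ≤ D := by rw [hz, abs_neg]; exact abs_clip_le hD _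
    have hq := discountedRss_nonneg β g t
    have h1 := ih _ hzD
    have h2 := clip_step_optimal hD hq (discountedSum_eq_zero_of_discountedRss hβ) hu (hz t)
    have hw : |z (t + 1) - u| ≤ 2 * D := (abs_sub _ _).trans (by linarith)
    have h3 := stability_step (v := g (t + 1)) hD (mul_nonneg hβ.le hq) hw
    rw [← discountedRss_succ] at h3
    have hmono : β * discountedRss β g t ≤ discountedRss β g (t + 1) := by
      rw [discountedRss_succ]
      exact Real.le_sqrt_of_sq_le (by nlinarith [sq_nonneg (g (t + 1))])
    rw [discountedSum_succ, discountedSum_succ, smul_eq_mul, smul_eq_mul]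
    generalize discountedRss β g (t + 1) = q' at *
    generalize discountedRss β g t = q at *
    generalize discountedSum β g t = S at *
    generalize discountedSum β (fun s => g s * z s) t = R at *
    generalize z (t + 1) = z at *
    generalize g (t + 1) = v at *
    have h2' : S * z + q / (2 * D) * z ^ 2 + q / (2 * D) * (z - u) ^ 2 ≤
        S * u + q / (2 * D) * u ^ 2 := by
      have : (S + q * z / D) * (u - z) = S * u + q / (2 * D) * u ^ 2 -
          (S * z + q / (2 * D) * z ^ 2 + q / (2 * D) * (z - u) ^ 2) := by
        field_simp; ring
      linarith
    have h4 : β * R ≤ β * (S * u + q / (2 * D) * u ^ 2 - q / (2 * D) * (z - u) ^ 2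
        + 3 * D * q) := mul_le_mul_of_nonneg_left (by linarith) hβ.le
    have h5 : β * q / (2 * D) * u ^ 2 ≤ q' / (2 * D) * u ^ 2 := by gcongr
    have h6 : β * (q / (2 * D) * u ^ 2 - q / (2 * D) * (z - u) ^ 2) =
      β * q / (2 * D) * u ^ 2 - β * q / (2 * D) * (z - u) ^ 2 := by ring
    nlinarith

/-- Discounted regret against the best fixed comparator in `[-D, D]`. -/
lemma abs_discountedSum_le_of_clip {β D : ℝ} (hβ : 0 < β) (hD : 0 < D) (g z : ℕ → ℝ)
    (hz : ∀ t, z (t + 1) = -clip D (D * (discountedSum β g t / discountedRss β g t)))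
    (t : ℕ) : D * |discountedSum β g t| ≤
      7 / 2 * D * discountedRss β g t - discountedSum β (fun s => g s * z s) t := by
  -- At `u = ±D` the regularizer costs `q D / 2`, which with the stability term `3 D q` makes `7/2`.
  have hq : discountedRss β g t / (2 * D) * D ^ 2 = D / 2 * discountedRss β g t := by
    field_simp
  rcases abs_cases (discountedSum β g t) with ⟨h, _⟩ | ⟨h, _⟩
  · have := discounted_regret hβ hD g z hz t (-D) (by rw [abs_neg, abs_of_pos hD])
    rw [neg_sq] at this
    rw [h]; linarith
  · have := discounted_regret hβ hD g z hz t D (by rw [abs_of_pos hD])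
    rw [h]; linarith

end Regret

/-! ### The exponential law and its integration by parts. -/

section Exponential

lemma expMeasure_one_eq : expMeasure 1 =
    (volume.restrict (Set.Ioi (0 : ℝ))).withDensity (fun x => ENNReal.ofReal (Real.exp (-x))) := by
  rw [← withDensity_indicator measurableSet_Ioi]
  refine withDensity_congr_ae ?_
  have : ∀ᵐ x : ℝ, x ≠ 0 := by simp [ae_iff]
  filter_upwards [this] with x hx
  rcases lt_or_gt_of_ne hx with h | h
  · rw [gammaPDF_of_neg h, Set.indicator_of_notMem (by simpa using h.le)]
  · rw [gammaPDF_of_nonneg h.le, Set.indicator_of_mem (by simpa using h)]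
    simp

lemma integral_expMeasure_one (f : ℝ → ℝ) :
    ∫ x, f x ∂(expMeasure 1) = ∫ x in Set.Ioi 0, Real.exp (-x) * f x := by
  rw [expMeasure_one_eq, integral_withDensity_eq_integral_toReal_smul (by fun_prop) (by simp)]
  simp [Real.exp_nonneg]

lemma integrable_expMeasure_one_iff (f : ℝ → ℝ) :
    Integrable f (expMeasure 1) ↔ IntegrableOn (fun x => Real.exp (-x) * f x) (Set.Ioi 0) := by
  rw [expMeasure_one_eq, integrable_withDensity_iff_integrable_smul' (by fun_prop) (by simp)]
  simp [Real.exp_nonneg, IntegrableOn]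

lemma integrable_pow_expMeasure_one (n : ℕ) : Integrable (fun x : ℝ => x ^ n) (expMeasure 1) := by
  rw [integrable_expMeasure_one_iff]
  have := Real.GammaIntegral_convergent (s := n + 1) (by positivity)
  simpa using this

lemma integral_sq_expMeasure_one : ∫ x, x ^ 2 ∂(expMeasure 1) = 2 := by
  rw [integral_expMeasure_one]
  have := Real.Gamma_eq_integral (s := 3) (by norm_num)
  have h2 : Real.Gamma 3 = 2 := by
    simp [Real.Gamma_ofNat_eq_factorial]
  rw [h2] at this
  rw [this]
  refine setIntegral_congr_fun measurableSet_Ioi fun x _ => ?_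
  norm_num

/-- Integration by parts against the exponential law, without continuity of the derivative. -/
lemma integral_sub_eq_integral_deriv_expMeasure {φ φ' : ℝ → ℝ} {M : ℝ}
    (hφ : ∀ a, HasDerivAt φ (φ' a) a) (hφ' : Measurable φ') (hM : ∀ a, |φ' a| ≤ M) :
    ∫ a, (φ a - φ 0) ∂(expMeasure 1) = ∫ a, φ' a ∂(expMeasure 1) := by
  have : IsProbabilityMeasure (expMeasure 1) := isProbabilityMeasure_expMeasure one_pos
  have hlip : ∀ a, |φ a - φ 0| ≤ M * |a| := by
    intro a
    have := Convex.norm_image_sub_le_of_norm_hasDerivWithin_le (f := φ) (f' := φ') (C := M)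
      (s := Set.univ) (x := 0) (y := a) (fun x _ => (hφ x).hasDerivWithinAt)
      (fun x _ => hM x) convex_univ (Set.mem_univ _) (Set.mem_univ _)
    simpa using this
  have hφc : Continuous φ := continuous_iff_continuousAt.2 fun a => (hφ a).continuousAt
  have hi1 : Integrable (fun a => φ a - φ 0) (expMeasure 1) := by
    have h1 := ((integrable_pow_expMeasure_one 1).abs).const_mul M
    refine h1.mono' (by fun_prop) (.of_forall fun a => ?_)
    simpa using hlip a
  have hi2 : Integrable φ' (expMeasure 1) :=
    (integrable_const M).mono' hφ'.aestronglyMeasurable (.of_forall hM)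
  rw [integrable_expMeasure_one_iff] at hi1 hi2
  rw [integral_expMeasure_one, integral_expMeasure_one, ← sub_eq_zero, ← integral_sub hi1 hi2]
  -- This antiderivative of the difference of the two integrands vanishes at 0 and at infinity.
  have hd : ∀ a ∈ Set.Ioi (0 : ℝ), HasDerivAt (fun a => -(Real.exp (-a) * (φ a - φ 0)))
      (Real.exp (-a) * (φ a - φ 0) - Real.exp (-a) * φ' a) a := by
    intro a _
    have h1 : HasDerivAt (fun a : ℝ => Real.exp (-a)) (-Real.exp (-a)) a := by
      simpa using (hasDerivAt_id a).neg.exp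
    convert! (h1.mul ((hφ a).sub_const (φ 0))).neg using 1
    ring
  rw [integral_Ioi_of_hasDerivAt_of_tendsto (m := 0) (by fun_prop) hd (hi1.sub hi2)]
  · simp
  · have hlim : Filter.Tendsto (fun a : ℝ => M * (a ^ 1 * Real.exp (-a))) Filter.atTop (nhds 0) := by
      simpa using (Real.tendsto_pow_mul_exp_neg_atTop_nhds_zero 1).const_mul M
    refine squeeze_zero_norm' ?_ hlim
    filter_upwards [Filter.eventually_ge_atTop (0 : ℝ)] with a ha
    rw [norm_neg, norm_mul, Real.norm_eq_abs, Real.norm_eq_abs, Real.abs_exp]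
    have := hlip a
    rw [abs_of_nonneg ha] at this
    nlinarith [Real.exp_pos (-a)]

end Exponential

/-! ### The regularized gradient norm: competitors, bounds and continuity. -/

section RegNorm

variable {d : ℕ} {F : E d → ℝ} {G : Fin d → ℝ} {lam : ℝ}

lemma measurable_gradient (F : E d → ℝ) : Measurable (fun y => gradient F y) := by
  unfold gradient
  exact (LinearIsometryEquiv.continuous _).measurable.comp (measurable_fderiv ℝ F)

lemma norm_le_l1Norm (v : E d) : ‖v‖ ≤ l1Norm v := by
  rw [EuclideanSpace.norm_eq]
  refine Real.sqrt_le_iff.2 ⟨Finset.sum_nonneg fun _ _ => abs_nonneg _, ?_⟩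
  exact Finset.sum_sq_le_sq_sum_of_nonneg fun _ _ => norm_nonneg _

lemma l1Norm_nonneg (v : Fin d → ℝ) : 0 ≤ l1Norm v := Finset.sum_nonneg fun _ _ => abs_nonneg _

lemma l1Norm_mono {v w : Fin d → ℝ} (h : ∀ i, |v i| ≤ w i) : l1Norm v ≤ l1Norm w :=
  Finset.sum_le_sum fun i _ => (h i).trans (le_abs_self _)

lemma norm_gradient_le (hG : ∀ x i, |gradient F x i| ≤ G i) (x : E d) :
    ‖gradient F x‖ ≤ l1Norm G :=
  (norm_le_l1Norm _).trans (l1Norm_mono (hG x))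

lemma integrable_gradient (hG : ∀ x i, |gradient F x i| ≤ G i) (p : Measure (E d))
    [IsFiniteMeasure p] : Integrable (fun y => gradient F y) p :=
  (integrable_const (l1Norm G)).mono' (measurable_gradient F).aestronglyMeasurable
    (.of_forall (norm_gradient_le hG))

lemma isAdmissible_of_integrable_sq (hG : ∀ x i, |gradient F x i| ≤ G i) {p : Measure (E d)}
    [hp : IsProbabilityMeasure p] (h2 : Integrable (fun y => ‖y‖ ^ 2) p) {x : E d}
    (hx : ∫ y, y ∂p = x) : IsAdmissible F x p where
  isProb := hp
  memLp := (memLp_two_iff_integrable_sq_norm aestronglyMeasurable_id).2 h2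
  mean := hx
  integrable_gradient := integrable_gradient hG p

lemma regNorm₁_nonneg (hlam : 0 ≤ lam) (x : E d) : 0 ≤ regNorm₁ lam F x := by
  refine Real.sInf_nonneg ?_
  rintro c ⟨p, _, rfl⟩
  exact add_nonneg (l1Norm_nonneg _)
    (mul_nonneg hlam (integral_nonneg fun _ => by positivity))

lemma regNorm₁_le (hlam : 0 ≤ lam) {x : E d} {p : Measure (E d)} (hp : IsAdmissible F x p) :
    regNorm₁ lam F x ≤
      l1Norm (fun i => (∫ y, gradient F y ∂p) i) + lam * ∫ y, ‖y - x‖ ^ 2 ∂p := by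
  refine csInf_le ⟨0, ?_⟩ ⟨p, hp, rfl⟩
  rintro c ⟨q, _, rfl⟩
  exact add_nonneg (l1Norm_nonneg _)
    (mul_nonneg hlam (integral_nonneg fun _ => by positivity))

/-- The finitely supported measure with weights `w` at the points `y`. -/
def weightedDirac {ι : Type*} (s : Finset ι) (w : ι → ℝ) (y : ι → E d) : Measure (E d) :=
  ∑ j ∈ s, ENNReal.ofReal (w j) • Measure.dirac (y j)

lemma integrable_weightedDirac {ι V : Type*} [NormedAddCommGroup V] (s : Finset ι) (w : ι → ℝ)
    (y : ι → E d) {f : E d → V} (hf : StronglyMeasurable f) :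
    Integrable f (weightedDirac s w y) := by
  refine integrable_finsetSum_measure.2 fun j _ => Integrable.smul_measure ?_ (by simp)
  refine ⟨hf.aestronglyMeasurable, ?_⟩
  rw [hasFiniteIntegral_iff_enorm, lintegral_dirac' _ hf.enorm]
  exact enorm_lt_top

lemma integral_weightedDirac {ι V : Type*} [NormedAddCommGroup V] [NormedSpace ℝ V]
    [CompleteSpace V] (s : Finset ι) {w : ι → ℝ} (hw : ∀ j ∈ s, 0 ≤ w j)
    (y : ι → E d) {f : E d → V} (hf : StronglyMeasurable f) :
    ∫ x, f x ∂(weightedDirac s w y) = ∑ j ∈ s, w j • f (y j) := by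
  have := integrable_finsetSum_measure.1 (integrable_weightedDirac s w y hf)
  unfold weightedDirac
  rw [integral_finsetSum_measure this]
  refine Finset.sum_congr rfl fun j hj => ?_
  rw [integral_smul_measure, integral_dirac, ENNReal.toReal_ofReal (hw j hj)]

lemma isProbabilityMeasure_weightedDirac {ι : Type*} (s : Finset ι) {w : ι → ℝ}
    (hw : ∀ j ∈ s, 0 ≤ w j) (hw1 : ∑ j ∈ s, w j = 1) (y : ι → E d) :
    IsProbabilityMeasure (weightedDirac s w y) := by
  constructor
  simp only [weightedDirac, Measure.coe_finsetSum, Finset.sum_apply, Measure.smul_apply,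
    measure_univ, smul_eq_mul, mul_one]
  rw [← ENNReal.ofReal_sum_of_nonneg hw, hw1, ENNReal.ofReal_one]

/-- The competitor in the infimum is a finitely supported law; for the EMA it is the discounted law
on the iterates. -/
lemma regNorm₁_le_weighted_sum (hG : ∀ x i, |gradient F x i| ≤ G i) (hlam : 0 ≤ lam)
    {ι : Type*} (s : Finset ι) {w : ι → ℝ} (hw : ∀ j ∈ s, 0 ≤ w j) (hw1 : ∑ j ∈ s, w j = 1)
    (y : ι → E d) {x : E d} (hx : ∑ j ∈ s, w j • y j = x) :
    regNorm₁ lam F x ≤ l1Norm (fun i => ∑ j ∈ s, w j * gradient F (y j) i) +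
      lam * ∑ j ∈ s, w j * ‖y j - x‖ ^ 2 := by
  have := isProbabilityMeasure_weightedDirac s hw hw1 y
  have hp : IsAdmissible F x (weightedDirac s w y) :=
    isAdmissible_of_integrable_sq hG
      (integrable_weightedDirac s w y (by fun_prop : Continuous _).stronglyMeasurable)
      ((integral_weightedDirac s hw y stronglyMeasurable_id).trans hx)
  refine (regNorm₁_le hlam hp).trans (le_of_eq ?_)
  rw [integral_weightedDirac s hw y (measurable_gradient F).stronglyMeasurable,
    integral_weightedDirac s hw y (by fun_prop : Continuous _).stronglyMeasurable]
  simp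

/-- The Dirac mass at `x` is a competitor with no variance cost. The bound is the dominating
constant for integrability. -/
lemma regNorm₁_le_l1Norm (hG : ∀ x i, |gradient F x i| ≤ G i) (hlam : 0 ≤ lam) (x : E d) :
    regNorm₁ lam F x ≤ l1Norm G := by
  have := regNorm₁_le_weighted_sum hG hlam ({()} : Finset Unit) (w := fun _ => 1) (by simp)
    (by simp) (fun _ => x) (x := x) (by simp)
  simp only [Finset.sum_singleton, one_mul, sub_self, norm_zero] at this
  have h := l1Norm_mono (hG x)
  simp only [ne_eq, OfNat.ofNat_ne_zero, not_false_eq_true, zero_pow, mul_zero, add_zero] at this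
  exact this.trans h

lemma integral_norm_sub_sq_eq {p : Measure (E d)} [IsProbabilityMeasure p]
    (h2 : MemLp (fun y : E d => y) 2 p) (x : E d) (hx : ∫ y, y ∂p = x) (x' : E d) :
    ∫ y, ‖y - x'‖ ^ 2 ∂p = ∫ y, ‖y - x‖ ^ 2 ∂p + ‖x - x'‖ ^ 2 := by
  have hsub : MemLp (fun y : E d => y - x) 2 p := h2.sub (memLp_const x)
  have hi : Integrable (fun y : E d => y - x) p := hsub.integrable one_le_two
  have hi2 : Integrable (fun y : E d => ‖y - x‖ ^ 2) p := hsub.integrable_norm_pow two_ne_zero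
  have hin : Integrable (fun y : E d => inner ℝ (x - x') (y - x)) p := hi.const_inner _
  have hzero : ∫ y, inner ℝ (x - x') (y - x) ∂p = 0 := by
    rw [integral_inner hi, integral_sub (h2.integrable one_le_two) (integrable_const x), hx]
    simp
  have e : ∀ y : E d, ‖y - x'‖ ^ 2 =
      ‖y - x‖ ^ 2 + (2 * inner ℝ (x - x') (y - x) + ‖x - x'‖ ^ 2) := by
    intro y
    rw [show y - x' = (y - x) + (x - x') by abel, norm_add_sq_real, real_inner_comm]
    ring
  rw [integral_congr_ae (.of_forall e)]
  have hi3 : Integrable (fun y : E d => 2 * inner ℝ (x - x') (y - x) + ‖x - x'‖ ^ 2) p :=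
    (hin.const_mul 2).add (integrable_const _)
  rw [integral_add hi2 hi3,
    integral_add (hin.const_mul 2) (integrable_const _), integral_const_mul, hzero]
  simp

/-- A law `p` with mean `x` is moved to mean `x'` by mixing in mass `θ = ‖x' - x‖` at the point at
distance 1 from `x` towards `x'`. Both terms of the objective grow by `O(θ)`. The resulting
continuity provides measurability of the infimum. -/
lemma regNorm₁_le_add (hG : ∀ x i, |gradient F x i| ≤ G i) (hlam : 0 ≤ lam) {x x' : E d}
    (h : ‖x' - x‖ ≤ 1) :
    regNorm₁ lam F x' ≤ regNorm₁ lam F x + ‖x' - x‖ * (l1Norm G + lam) := by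
  rcases eq_or_ne x' x with rfl | hne
  · simp
  set θ := ‖x' - x‖ with hθ
  have hθ0 : 0 < θ := norm_pos_iff.2 (sub_ne_zero.2 hne)
  have hθ1 : 0 ≤ 1 - θ := by linarith
  rw [← sub_le_iff_le_add]
  have hdirac : IsAdmissible F x (Measure.dirac x) := by
    refine isAdmissible_of_integrable_sq hG ?_ (by simp)
    refine integrable_dirac' (by fun_prop : Continuous _).stronglyMeasurable ?_
    exact enorm_lt_top
  refine le_csInf ⟨_, Measure.dirac x, hdirac, rfl⟩ ?_
  rintro c ⟨p, hp, rfl⟩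
  have := hp.isProb
  set y₀ := x + θ⁻¹ • (x' - x) with hy₀
  set q := ENNReal.ofReal (1 - θ) • p + ENNReal.ofReal θ • Measure.dirac y₀ with hq
  have hqp : IsProbabilityMeasure q := by
    constructor
    simp only [hq, Measure.coe_add, Measure.coe_smul, Pi.add_apply, Pi.smul_apply, measure_univ,
      smul_eq_mul, mul_one]
    rw [← ENNReal.ofReal_add hθ1 hθ0.le]
    simp
  have hint : ∀ {V : Type} [NormedAddCommGroup V] [NormedSpace ℝ V] [CompleteSpace V]
      {f : E d → V}, StronglyMeasurable f → Integrable f p →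
      Integrable f q ∧ ∫ y, f y ∂q = (1 - θ) • ∫ y, f y ∂p + θ • f y₀ := by
    intro V _ _ _ f hf hfp
    have h1 : Integrable f (ENNReal.ofReal (1 - θ) • p) := hfp.smul_measure (by simp)
    have h2 : Integrable f (ENNReal.ofReal θ • Measure.dirac y₀) :=
      (integrable_dirac' hf enorm_lt_top).smul_measure (by simp)
    refine ⟨h1.add_measure h2, ?_⟩
    rw [integral_add_measure h1 h2, integral_smul_measure, integral_smul_measure, integral_dirac,
      ENNReal.toReal_ofReal hθ1, ENNReal.toReal_ofReal hθ0.le]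
  have hmean := hint stronglyMeasurable_id (hp.memLp.integrable one_le_two)
  have hsq := hint (f := fun y => ‖y‖ ^ 2) (by fun_prop : Continuous _).stronglyMeasurable
    (hp.memLp.integrable_norm_pow two_ne_zero)
  have hsq' := hint (f := fun y => ‖y - x'‖ ^ 2) (by fun_prop : Continuous _).stronglyMeasurable
    ((hp.memLp.sub (memLp_const x')).integrable_norm_pow two_ne_zero)
  have hgr := hint (measurable_gradient F).stronglyMeasurable hp.integrable_gradient
  have hqx : ∫ y, y ∂q = x' := by
    refine hmean.2.trans ?_
    simp only [id]
    rw [hp.mean, hy₀, smul_add, smul_smul, mul_inv_cancel₀ hθ0.ne', one_smul, sub_smul, one_smul]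
    abel
  have hqa : IsAdmissible F x' q := isAdmissible_of_integrable_sq hG hsq.1 hqx
  have h1 := regNorm₁_le hlam hqa
  rw [hgr.2, hsq'.2, integral_norm_sub_sq_eq hp.memLp x hp.mean x'] at h1
  have hy₀x : ‖y₀ - x'‖ = 1 - θ := by
    have : y₀ - x' = (θ⁻¹ - 1) • (x' - x) := by
      rw [hy₀, sub_smul, one_smul]; abel
    have hinv : 1 ≤ θ⁻¹ := (one_le_inv₀ hθ0).2 h
    rw [this, norm_smul, Real.norm_eq_abs, abs_of_nonneg (by linarith), ← hθ]
    field_simp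
  rw [hy₀x, norm_sub_rev x x', ← hθ] at h1
  have h2 : l1Norm (fun i => ((1 - θ) • ∫ y, gradient F y ∂p + θ • gradient F y₀ : E d) i) ≤
      l1Norm (fun i => (∫ y, gradient F y ∂p) i) + θ * l1Norm G := by
    unfold l1Norm
    rw [Finset.mul_sum, ← Finset.sum_add_distrib]
    refine Finset.sum_le_sum fun i _ => ?_
    simp only [PiLp.add_apply, PiLp.smul_apply, smul_eq_mul]
    refine (abs_add_le _ _).trans (add_le_add ?_ ?_)
    · rw [abs_mul, abs_of_nonneg hθ1]
      exact mul_le_of_le_one_left (abs_nonneg _) (by linarith)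
    · rw [abs_mul, abs_of_pos hθ0]
      exact mul_le_mul_of_nonneg_left ((hG y₀ i).trans (le_abs_self _)) hθ0.le
  have hV : 0 ≤ ∫ y, ‖y - x‖ ^ 2 ∂p := integral_nonneg fun _ => by positivity
  set V := ∫ y, ‖y - x‖ ^ 2 ∂p
  have h3 : (1 - θ) • (V + θ ^ 2) + θ • (1 - θ) ^ 2 ≤ V + θ := by
    simp only [smul_eq_mul]
    nlinarith [mul_nonneg hθ0.le hV, sq_nonneg θ]
  nlinarith [mul_le_mul_of_nonneg_left h3 hlam]

lemma continuous_regNorm₁ (hG : ∀ x i, |gradient F x i| ≤ G i) (hlam : 0 ≤ lam) :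
    Continuous (regNorm₁ lam F) := by
  set K := l1Norm G + lam with hK
  have hK0 : 0 ≤ K := add_nonneg (l1Norm_nonneg _) hlam
  refine Metric.continuous_iff.2 fun x ε hε => ⟨min 1 (ε / (K + 1)), by positivity, ?_⟩
  intro x' hx'
  rw [dist_eq_norm] at hx'
  have h1 : ‖x' - x‖ ≤ 1 := (hx'.trans_le (min_le_left _ _)).le
  have h2 : ‖x' - x‖ * (K + 1) < ε := by
    rw [← lt_div_iff₀ (by positivity)]
    exact hx'.trans_le (min_le_right _ _)
  have h3 := regNorm₁_le_add hG hlam h1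
  have h4 := regNorm₁_le_add hG hlam (x := x') (x' := x) (by rwa [norm_sub_rev])
  rw [norm_sub_rev x x'] at h4
  rw [← hK] at h3 h4
  rw [Real.dist_eq, abs_lt]
  have := norm_nonneg (x' - x)
  constructor <;> nlinarith

end RegNorm

/-! ### Pathwise bounds along a fixed realization. -/

section Trajectory

variable {d : ℕ} {Z : Type*} (β D : ℝ) (stoGrad : E d → Z → E d) (x₀ : E d)
  (α : ℕ → ℝ) (r : ℕ → Z)

/-- The iterate `x_t` of the conversion run with clipped-Adam. -/
def iter (t : ℕ) : E d := (conversion (clippedAdam β (β ^ 2) D) stoGrad x₀ α r t).1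

/-- The stochastic gradient `g_t` observed at time `t` (zero at time `0`). -/
def observed (t : ℕ) : E d := (conversion (clippedAdam β (β ^ 2) D) stoGrad x₀ α r t).2 t

/-- The increment `z_t` chosen by clipped-Adam (zero at time `0`). -/
def incr : ℕ → E d
  | 0 => 0
  | t + 1 => clippedAdam β (β ^ 2) D
      (conversion (clippedAdam β (β ^ 2) D) stoGrad x₀ α r t).2 t

lemma iter_succ (t : ℕ) : iter β D stoGrad x₀ α r (t + 1) =
    iter β D stoGrad x₀ α r t + α (t + 1) • incr β D stoGrad x₀ α r (t + 1) := rfl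

lemma observed_succ (t : ℕ) : observed β D stoGrad x₀ α r (t + 1) =
    stoGrad (iter β D stoGrad x₀ α r (t + 1)) (r (t + 1)) :=
  Function.update_self _ _ _

/-- Later updates touch only later indices, so recorded gradients persist. -/
lemma conversion_snd_of_le {s t : ℕ} (h : s ≤ t) :
    (conversion (clippedAdam β (β ^ 2) D) stoGrad x₀ α r t).2 s =
      observed β D stoGrad x₀ α r s := by
  induction t, h using Nat.le_induction with
  | base => rfl
  | succ t hst ih =>
    rw [← ih]
    exact Function.update_of_ne (by omega) _ _

lemma incr_succ_apply (t : ℕ) (i : Fin d) : incr β D stoGrad x₀ α r (t + 1) i =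
    -clip D (D * (discountedSum β (fun s => observed β D stoGrad x₀ α r s i) t /
      discountedRss β (fun s => observed β D stoGrad x₀ α r s i) t)) := by
  have h : ∀ s ∈ Finset.Icc 1 t, (conversion (clippedAdam β (β ^ 2) D) stoGrad x₀ α r t).2 s =
      observed β D stoGrad x₀ α r s := fun s hs =>
    conversion_snd_of_le _ _ _ _ _ _ (Finset.mem_Icc.1 hs).2
  simp only [incr, clippedAdam, discountedRss, discountedSum, smul_eq_mul]
  congr 4
  · exact Finset.sum_congr rfl fun s hs => by rw [h s hs]
  · congr 1
    exact Finset.sum_congr rfl fun s hs => by rw [h s hs]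

variable {D} in
lemma abs_incr_le (hD : 0 < D) (t : ℕ) (i : Fin d) : |incr β D stoGrad x₀ α r t i| ≤ D := by
  cases t with
  | zero => simpa [incr] using hD.le
  | succ t =>
    rw [incr_succ_apply, abs_neg]
    exact abs_clip_le hD _

variable {D} in
lemma norm_incr_sq_le (hD : 0 < D) (t : ℕ) : ‖incr β D stoGrad x₀ α r t‖ ^ 2 ≤ d * D ^ 2 := by
  rw [EuclideanSpace.norm_sq_eq]
  calc _ ≤ ∑ _i : Fin d, D ^ 2 := Finset.sum_le_sum fun i _ => by
        rw [Real.norm_eq_abs]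
        exact pow_le_pow_left₀ (abs_nonneg _) (abs_incr_le β stoGrad x₀ α r hD t i) 2
    _ = _ := by simp

-- Triangle inequality followed by Cauchy–Schwarz over the `t - s` steps, so that only second
-- moments of the multipliers are needed later.
variable {D} in
lemma norm_iter_sub_sq_le (hD : 0 < D) {s t : ℕ} (h : s ≤ t) :
    ‖iter β D stoGrad x₀ α r s - iter β D stoGrad x₀ α r t‖ ^ 2 ≤
      d * D ^ 2 * ((t - s : ℕ) * ∑ k ∈ Finset.Ioc s t, α k ^ 2) := by
  have h1 : ‖iter β D stoGrad x₀ α r s - iter β D stoGrad x₀ α r t‖ ≤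
      ∑ k ∈ Finset.Ioc s t, |α k| * √(d * D ^ 2) := by
    induction t, h using Nat.le_induction with
    | base => simp
    | succ t hst ih =>
      rw [Finset.sum_Ioc_succ_top (by omega), iter_succ, sub_add_eq_sub_sub]
      refine (norm_sub_le _ _).trans (add_le_add ih ?_)
      rw [norm_smul, Real.norm_eq_abs]
      refine mul_le_mul_of_nonneg_left ?_ (abs_nonneg _)
      exact Real.le_sqrt_of_sq_le (norm_incr_sq_le β stoGrad x₀ α r hD _)
  have h2 := pow_le_pow_left₀ (norm_nonneg _) h1 2
  refine h2.trans ?_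
  rw [← Finset.sum_mul, mul_pow, Real.sq_sqrt (by positivity), mul_comm]
  refine mul_le_mul_of_nonneg_left ?_ (by positivity)
  have := sq_sum_le_card_mul_sum_sq (s := Finset.Ioc s t) (f := fun k => |α k|)
  simpa using this

/-- The mean minimizes the weighted second moment. Hence the spread around the EMA can be measured
from the last iterate `x_t` instead. -/
lemma sum_weight_norm_sub_sq_le {ι : Type*} (s : Finset ι) {w : ι → ℝ}
    (hw1 : ∑ j ∈ s, w j = 1) {y : ι → E d} {x : E d} (hx : ∑ j ∈ s, w j • y j = x) (a : E d) :
    ∑ j ∈ s, w j * ‖y j - x‖ ^ 2 ≤ ∑ j ∈ s, w j * ‖y j - a‖ ^ 2 := by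
  have hz : ∑ j ∈ s, w j * inner ℝ (y j - x) (x - a) = 0 := by
    have : ∑ j ∈ s, w j • (y j - x) = 0 := by
      simp only [smul_sub, Finset.sum_sub_distrib, hx, ← Finset.sum_smul, hw1, one_smul, sub_self]
    have h := congrArg (fun v => inner ℝ v (x - a)) this
    simpa [sum_inner, real_inner_smul_left] using h
  have e : ∀ j, w j * ‖y j - a‖ ^ 2 =
      w j * ‖y j - x‖ ^ 2 + (2 * (w j * inner ℝ (y j - x) (x - a)) + w j * ‖x - a‖ ^ 2) := by
    intro j
    rw [show y j - a = (y j - x) + (x - a) by abel, norm_add_sq_real]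
    ring
  rw [Finset.sum_congr rfl fun j _ => e j, Finset.sum_add_distrib, Finset.sum_add_distrib,
    ← Finset.mul_sum, hz, ← Finset.sum_mul, hw1]
  have := sq_nonneg ‖x - a‖
  linarith

lemma ema_eq_discountedSum {β : ℝ} (hβ₀ : 0 ≤ β) (hβ₁ : β < 1) (x : ℕ → E d) {t : ℕ}
    (ht : 1 ≤ t) : ema β x t = ((1 - β) / (1 - β ^ t)) • discountedSum β x t := by
  have hpos : ∀ t, 1 ≤ t → 0 < 1 - β ^ t := fun t ht =>
    sub_pos.2 (pow_lt_one₀ hβ₀ hβ₁ (by omega))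
  induction t, ht using Nat.le_induction with
  | base =>
    rw [discountedSum_succ]
    simp [ema]
  | succ t ht ih =>
    have h1 := (hpos t ht).ne'
    have h2 := (hpos (t + 1) (by omega)).ne'
    rw [ema, ih, discountedSum_succ, smul_add, smul_smul, smul_smul]
    congr 2
    rw [pow_succ'] at h2 ⊢
    field_simp

/-- The bound for the variance of the exponentially weighted iterates at time `t`. -/
def spread (β : ℝ) (α : ℕ → ℝ) (t : ℕ) : ℝ :=
  discountedSum β (fun s => (t - s : ℕ) * ∑ k ∈ Finset.Ioc s t, α k ^ 2) t

lemma regNorm₁_ema_le {F : E d → ℝ} {G : Fin d → ℝ} (hG : ∀ x i, |gradient F x i| ≤ G i)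
    {lam : ℝ} (hlam : 0 ≤ lam) {β D : ℝ} (hβ₀ : 0 ≤ β) (hβ₁ : β < 1) (hD : 0 < D)
    {t : ℕ} (ht : 1 ≤ t) :
    regNorm₁ lam F (adamEMA β D stoGrad x₀ α r t) ≤
      (1 - β) * ∑ i, |discountedSum β (fun s => gradient F (iter β D stoGrad x₀ α r s) i) t|
        + β ^ t * l1Norm G
        + lam * (d * D ^ 2) * ((1 - β) / (1 - β ^ t) * spread β α t) := by
  set X := iter β D stoGrad x₀ α r with hX
  set c := (1 - β) / (1 - β ^ t) with hc
  have hb : 0 < 1 - β := sub_pos.2 hβ₁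
  have hbt : 0 < 1 - β ^ t := sub_pos.2 (pow_lt_one₀ hβ₀ hβ₁ (by omega))
  have hc0 : 0 < c := div_pos hb hbt
  have hone : c * discountedSum β (fun _ => (1 : ℝ)) t = 1 := by
    rw [hc, div_mul_eq_mul_div, discountedSum_const_one, div_self hbt.ne']
  have hw : ∀ s ∈ Finset.Icc 1 t, 0 ≤ c * β ^ (t - s) := fun s _ => by positivity
  have hw1 : ∑ s ∈ Finset.Icc 1 t, c * β ^ (t - s) = 1 := by
    rw [← hone, discountedSum, Finset.mul_sum]
    simp
  have hx : ∑ s ∈ Finset.Icc 1 t, (c * β ^ (t - s)) • X s = adamEMA β D stoGrad x₀ α r t := by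
    refine Eq.trans ?_ (ema_eq_discountedSum hβ₀ hβ₁ X ht).symm
    rw [discountedSum, Finset.smul_sum]
    simp [mul_smul, hc]
  refine (regNorm₁_le_weighted_sum hG hlam _ hw hw1 X hx).trans ?_
  have hgrad : l1Norm (fun i => ∑ s ∈ Finset.Icc 1 t, c * β ^ (t - s) * gradient F (X s) i) ≤
      (1 - β) * ∑ i, |discountedSum β (fun s => gradient F (X s) i) t| + β ^ t * l1Norm G := by
    unfold l1Norm
    rw [Finset.mul_sum, Finset.mul_sum, ← Finset.sum_add_distrib]
    refine Finset.sum_le_sum fun i _ => ?_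
    have e : ∑ s ∈ Finset.Icc 1 t, c * β ^ (t - s) * gradient F (X s) i =
        c * discountedSum β (fun s => gradient F (X s) i) t := by
      rw [discountedSum, Finset.mul_sum]
      simp [mul_assoc]
    beta_reduce
    rw [e, abs_mul, abs_of_pos hc0]
    have h1 : c * |discountedSum β (fun s => gradient F (X s) i) t| ≤ |G i| := by
      have h2 : |discountedSum β (fun s => gradient F (X s) i) t| ≤
          G i * discountedSum β (fun _ => (1 : ℝ)) t := by
        refine (abs_discountedSum_le hβ₀ _ t).trans ?_
        refine (discountedSum_mono hβ₀ fun s _ _ => hG (X s) i).trans (le_of_eq ?_)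
        simp [discountedSum, Finset.mul_sum, mul_comm]
      calc _ ≤ c * (G i * discountedSum β (fun _ => (1 : ℝ)) t) :=
            mul_le_mul_of_nonneg_left h2 hc0.le
        _ = G i * (c * discountedSum β (fun _ => (1 : ℝ)) t) := by ring
        _ ≤ |G i| := by rw [hone, mul_one]; exact le_abs_self _
    -- The excess of the normalized weight `c` over `1 - β` is `β^t c`; the averaged gradient
    -- coordinate is at most `|G i|`, so normalization costs only `β^t |G i|`.
    have h3 : c = (1 - β) + β ^ t * c := by
      rw [hc]; field_simp; ring
    have h4 := mul_le_mul_of_nonneg_left h1 (pow_nonneg hβ₀ t)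
    calc _ = (1 - β) * |discountedSum β (fun s => gradient F (X s) i) t| +
          β ^ t * (c * |discountedSum β (fun s => gradient F (X s) i) t|) := by
          nth_rewrite 1 [h3]; ring
      _ ≤ _ := by linarith
  have hvar : ∑ s ∈ Finset.Icc 1 t, c * β ^ (t - s) *
      ‖X s - adamEMA β D stoGrad x₀ α r t‖ ^ 2 ≤ d * D ^ 2 * (c * spread β α t) := by
    refine (sum_weight_norm_sub_sq_le _ hw1 hx (X t)).trans ?_
    rw [spread, discountedSum, Finset.mul_sum, Finset.mul_sum]
    refine Finset.sum_le_sum fun s hs => ?_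
    have h1 := norm_iter_sub_sq_le β stoGrad x₀ α r hD (Finset.mem_Icc.1 hs).2
    calc _ ≤ _ := mul_le_mul_of_nonneg_left h1 (hw s hs)
      _ = _ := by rw [smul_eq_mul]; ring
  have := mul_le_mul_of_nonneg_left hvar hlam
  linarith

/-- The oracle noise `g_t - ∇F(x_t)` (zero at time `0`). -/
def noise (F : E d → ℝ) : ℕ → E d
  | 0 => 0
  | t + 1 => observed β D stoGrad x₀ α r (t + 1) - gradient F (iter β D stoGrad x₀ α r (t + 1))

-- The true gradient is the observed one minus the noise; the regret bound controls the observed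
-- part.
variable {β D} in
lemma sum_abs_discountedSum_gradient_le (F : E d → ℝ) (hβ : 0 < β) (hD : 0 < D) (t : ℕ) :
    D * ∑ i, |discountedSum β (fun s => gradient F (iter β D stoGrad x₀ α r s) i) t| ≤
      ∑ i, (D * |discountedSum β (fun s => noise β D stoGrad x₀ α r F s i) t| +
        7 / 2 * D * discountedRss β (fun s => observed β D stoGrad x₀ α r s i) t -
        discountedSum β (fun s => observed β D stoGrad x₀ α r s i *
          incr β D stoGrad x₀ α r s i) t) := by
  rw [Finset.mul_sum]
  refine Finset.sum_le_sum fun i _ => ?_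
  have h1 := abs_discountedSum_le_of_clip hβ hD (fun s => observed β D stoGrad x₀ α r s i)
    (fun s => incr β D stoGrad x₀ α r s i) (fun t => incr_succ_apply β D stoGrad x₀ α r t i) t
  have h2 : discountedSum β (fun s => gradient F (iter β D stoGrad x₀ α r s) i) t =
      discountedSum β (fun s => observed β D stoGrad x₀ α r s i) t -
        discountedSum β (fun s => noise β D stoGrad x₀ α r F s i) t := by
    rw [← discountedSum_sub]
    refine discountedSum_congr fun s hs _ => ?_
    obtain ⟨s, rfl⟩ := Nat.exists_eq_add_of_le' hs
    simp [noise]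
  rw [h2]
  have h3 := mul_le_mul_of_nonneg_left
    (abs_sub (discountedSum β (fun s => observed β D stoGrad x₀ α r s i) t)
      (discountedSum β (fun s => noise β D stoGrad x₀ α r F s i) t)) hD.le
  linarith

end Trajectory

/-! ### Measurability of the trajectory in the random inputs. -/

section Measurability

variable {d : ℕ} {Z Ω : Type*} [MeasurableSpace Z] [MeasurableSpace Ω] {β D : ℝ}
  {stoGrad : E d → Z → E d} (x₀ : E d) {α : ℕ → Ω → ℝ} {r : ℕ → Ω → Z} {t : ℕ}

lemma measurable_clip (D : ℝ) : Measurable (clip D) := by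
  unfold clip
  fun_prop

lemma measurable_clippedAdam (β₁ β₂ D : ℝ) (t : ℕ) :
    Measurable (fun g : ℕ → E d => clippedAdam β₁ β₂ D g t) := by
  unfold clippedAdam
  refine (WithLp.measurable_toLp 2 _).comp (measurable_pi_lambda _ fun i => ?_)
  refine ((measurable_clip D).comp ?_).neg
  fun_prop

/-- Only inputs up to time `t` are assumed measurable, so the statement applies with the `σ`-algebra
`past α r t` as well as with the ambient one. -/
lemma measurable_conversion (hsg : Measurable (fun q : E d × Z => stoGrad q.1 q.2))
    (hα : ∀ s ≤ t, Measurable (α s)) (hr : ∀ s ≤ t, Measurable (r s)) :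
    Measurable (fun ω => conversion (clippedAdam β (β ^ 2) D) stoGrad x₀
      (fun s => α s ω) (fun s => r s ω) t) := by
  induction t with
  | zero => exact measurable_const
  | succ t ih =>
    have ih := ih (fun s hs => hα s (by omega)) (fun s hs => hr s (by omega))
    have hx : Measurable (fun ω => iter β D stoGrad x₀ (fun s => α s ω) (fun s => r s ω) (t + 1)) :=
      ih.fst.add ((hα (t + 1) le_rfl).smul ((measurable_clippedAdam β (β ^ 2) D t).comp ih.snd))
    refine hx.prodMk (measurable_pi_lambda _ fun s => ?_)
    rcases eq_or_ne s (t + 1) with rfl | hs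
    · simp only [Function.update_self]
      exact hsg.comp (hx.prodMk (hr (t + 1) le_rfl))
    · simp only [Function.update_of_ne hs]
      exact (measurable_pi_apply s).comp ih.snd

lemma measurable_iter (hsg : Measurable (fun q : E d × Z => stoGrad q.1 q.2))
    (hα : ∀ s ≤ t, Measurable (α s)) (hr : ∀ s ≤ t, Measurable (r s)) :
    Measurable (fun ω => iter β D stoGrad x₀ (fun s => α s ω) (fun s => r s ω) t) :=
  (measurable_conversion x₀ hsg hα hr).fst

lemma measurable_observed (hsg : Measurable (fun q : E d × Z => stoGrad q.1 q.2))
    (hα : ∀ s ≤ t, Measurable (α s)) (hr : ∀ s ≤ t, Measurable (r s)) :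
    Measurable (fun ω => observed β D stoGrad x₀ (fun s => α s ω) (fun s => r s ω) t) :=
  (measurable_pi_apply t).comp (measurable_conversion x₀ hsg hα hr).snd

/-- Predictability: `z_(t+1)` uses inputs up to time `t` only. -/
lemma measurable_incr_succ (hsg : Measurable (fun q : E d × Z => stoGrad q.1 q.2))
    (hα : ∀ s ≤ t, Measurable (α s)) (hr : ∀ s ≤ t, Measurable (r s)) :
    Measurable (fun ω => incr β D stoGrad x₀ (fun s => α s ω) (fun s => r s ω) (t + 1)) :=
  (measurable_clippedAdam β (β ^ 2) D t).comp (measurable_conversion x₀ hsg hα hr).snd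

lemma measurable_noise (hsg : Measurable (fun q : E d × Z => stoGrad q.1 q.2))
    (F : E d → ℝ) (hα : ∀ s ≤ t, Measurable (α s))
    (hr : ∀ s ≤ t, Measurable (r s)) :
    Measurable (fun ω => noise β D stoGrad x₀ (fun s => α s ω) (fun s => r s ω) F t) := by
  cases t with
  | zero => exact measurable_const
  | succ t =>
    exact (measurable_observed x₀ hsg hα hr).sub
      ((measurable_gradient F).comp (measurable_iter x₀ hsg hα hr))

end Measurability

lemma measurable_discountedSum {Ω : Type*} [MeasurableSpace Ω] (β : ℝ) {c : ℕ → Ω → ℝ} {t : ℕ}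
    (h : ∀ s ≤ t, Measurable (c s)) : Measurable (fun ω => discountedSum β (fun s => c s ω) t) := by
  unfold discountedSum
  exact Finset.measurable_fun_sum _ fun s hs =>
    (h s (Finset.mem_Icc.1 hs).2).const_smul (β ^ (t - s))

/-! ### Independence of fresh inputs from the past, as product laws. -/

section Independence

variable {Ω Z S : Type*} [MeasurableSpace Ω] [MeasurableSpace Z] [MeasurableSpace S]

/-- The `σ`-algebra of the random inputs up to time `t`. -/
@[reducible] def past (α : ℕ → Ω → ℝ) (r : ℕ → Ω → Z) (t : ℕ) : MeasurableSpace Ω :=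
  ⨆ s ∈ Set.Iic t, MeasurableSpace.comap (fun ω => (α s ω, r s ω)) inferInstance

lemma measurable_past (α : ℕ → Ω → ℝ) (r : ℕ → Ω → Z) {s t : ℕ} (h : s ≤ t) :
    Measurable[past α r t] (fun ω => (α s ω, r s ω)) :=
  Measurable.mono (comap_measurable _) (le_iSup₂_of_le s h le_rfl) le_rfl

variable {P : Measure Ω} [IsProbabilityMeasure P] {ν : Measure Z} [IsProbabilityMeasure ν]
  {α : ℕ → Ω → ℝ} {r : ℕ → Ω → Z}

lemma past_le (hS : IsSampling P ν α r) (t : ℕ) : past α r t ≤ ‹MeasurableSpace Ω› :=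
  iSup₂_le fun s _ => ((hS.measurable_α s).prodMk (hS.measurable_r s)).comap_le

/-- Independence is recorded as a product law so that Fubini can take the place of conditional
expectation. -/
lemma map_past_prod (hS : IsSampling P ν α r) {t : ℕ} {W : Ω → S}
    (hW : Measurable[past α r t] W) :
    P.map (fun ω => (W ω, (α (t + 1) ω, r (t + 1) ω))) =
      (P.map W).prod ((expMeasure 1).prod ν) := by
  have hm : ∀ s, Measurable (fun ω => (α s ω, r s ω)) := fun s =>
    (hS.measurable_α s).prodMk (hS.measurable_r s)
  have hind : Indep (past α r t)
      (⨆ s ∈ ({t + 1} : Set ℕ), MeasurableSpace.comap (fun ω => (α s ω, r s ω)) inferInstance) P :=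
    indep_iSup_of_disjoint (fun s => (hm s).comap_le) hS.indep
      (Set.disjoint_singleton_right.2 (by simp))
  have hfun : IndepFun W (fun ω => (α (t + 1) ω, r (t + 1) ω)) P :=
    indep_of_indep_of_le_left
      (indep_of_indep_of_le_right hind (le_iSup₂_of_le (t + 1) rfl le_rfl)) hW.comap_le
  have hW' : Measurable W := hW.mono (past_le hS t) le_rfl
  rw [(indepFun_iff_map_prod_eq_prod_map_map hW'.aemeasurable (hm _).aemeasurable).1 hfun,
    hS.law]

lemma map_multiplier (hS : IsSampling P ν α r) (t : ℕ) : P.map (α t) = expMeasure 1 := by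
  have : IsProbabilityMeasure (expMeasure 1) := isProbabilityMeasure_expMeasure one_pos
  have h := congrArg (Measure.map Prod.fst) (hS.law t)
  rw [Measure.map_map measurable_fst ((hS.measurable_α t).prodMk (hS.measurable_r t)),
    Measure.map_fst_prod, measure_univ, one_smul] at h
  exact h

lemma map_past_multiplier (hS : IsSampling P ν α r) {t : ℕ} {W : Ω → S}
    (hW : Measurable[past α r t] W) :
    P.map (fun ω => (W ω, α (t + 1) ω)) = (P.map W).prod (expMeasure 1) := by
  have : IsProbabilityMeasure (expMeasure 1) := isProbabilityMeasure_expMeasure one_pos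
  have hW' : Measurable W := hW.mono (past_le hS t) le_rfl
  have hm := hW'.prodMk ((hS.measurable_α (t + 1)).prodMk (hS.measurable_r (t + 1)))
  have h := congrArg (Measure.map (Prod.map id Prod.fst)) (map_past_prod hS hW)
  rw [Measure.map_map (by fun_prop) hm] at h
  refine h.trans ?_
  have : IsProbabilityMeasure (P.map W) := Measure.isProbabilityMeasure_map hW'.aemeasurable
  rw [← Measure.map_prod_map _ _ measurable_id measurable_fst, Measure.map_id,
    Measure.map_fst_prod, measure_univ, one_smul]

/-- The multiplier `α_(t+1)` joins the conditioning variable because `x_(t+1)` depends on it, while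
the seed `r_(t+1)` is still fresh. -/
lemma map_past_seed (hS : IsSampling P ν α r) {t : ℕ} {W : Ω → S}
    (hW : Measurable[past α r t] W) :
    P.map (fun ω => ((W ω, α (t + 1) ω), r (t + 1) ω)) =
      (P.map (fun ω => (W ω, α (t + 1) ω))).prod ν := by
  have : IsProbabilityMeasure (expMeasure 1) := isProbabilityMeasure_expMeasure one_pos
  have hW' : Measurable W := hW.mono (past_le hS t) le_rfl
  have : IsProbabilityMeasure (P.map W) := Measure.isProbabilityMeasure_map hW'.aemeasurable
  have hm := (hW'.prodMk (hS.measurable_α (t + 1))).prodMk (hS.measurable_r (t + 1))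
  rw [map_past_multiplier hS hW]
  refine MeasurableEquiv.prodAssoc.map_measurableEquiv_injective ?_
  rw [Measure.prodAssoc_prod, Measure.map_map MeasurableEquiv.prodAssoc.measurable hm]
  exact map_past_prod hS hW

end Independence

/-! ### Conditionally centred square-integrable variables. -/

section Noise

variable {Ω Z S : Type*} [MeasurableSpace Ω] [MeasurableSpace Z] [MeasurableSpace S]
  {P : Measure Ω} [IsProbabilityMeasure P] {ν : Measure Z} [IsProbabilityMeasure ν]

/-- A conditionally centred function with bounded conditional variance is square integrable and
orthogonal to the conditioning variable. -/
lemma conditionally_centred {X : Ω → S} {Y : Ω → Z} (hX : Measurable X) (hY : Measurable Y)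
    (hmap : P.map (fun ω => (X ω, Y ω)) = (P.map X).prod ν) {n : S × Z → ℝ} (hn : Measurable n)
    {v : ℝ} (h2 : ∀ s, MemLp (fun z => n (s, z)) 2 ν) (h0 : ∀ s, ∫ z, n (s, z) ∂ν = 0)
    (hv : ∀ s, ∫ z, n (s, z) ^ 2 ∂ν ≤ v) :
    MemLp (fun ω => n (X ω, Y ω)) 2 P ∧ ∫ ω, n (X ω, Y ω) ^ 2 ∂P ≤ v ∧
      ∀ ψ : S → ℝ, Measurable ψ → MemLp (fun ω => ψ (X ω)) 2 P →
        ∫ ω, ψ (X ω) * n (X ω, Y ω) ∂P = 0 := by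
  have hXY : Measurable (fun ω => (X ω, Y ω)) := hX.prodMk hY
  have : IsProbabilityMeasure (P.map X) := Measure.isProbabilityMeasure_map hX.aemeasurable
  have hn2 : Measurable (fun q => n q ^ 2) := hn.pow_const 2
  have hint : Integrable (fun q => n q ^ 2) ((P.map X).prod ν) := by
    rw [integrable_prod_iff hn2.aestronglyMeasurable]
    refine ⟨.of_forall fun s => (h2 s).integrable_sq, ?_⟩
    refine (integrable_const v).mono'
      hn2.stronglyMeasurable.norm.integral_prod_right.aestronglyMeasurable (.of_forall fun s => ?_)
    have e : ∫ z, ‖n (s, z) ^ 2‖ ∂ν = ∫ z, n (s, z) ^ 2 ∂ν := by simp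
    rw [e, Real.norm_of_nonneg (integral_nonneg fun _ => by positivity)]
    exact hv s
  have hintP : Integrable (fun ω => n (X ω, Y ω) ^ 2) P := by
    rw [← hmap, integrable_map_measure hn2.aestronglyMeasurable hXY.aemeasurable] at hint
    exact hint
  have hmem : MemLp (fun ω => n (X ω, Y ω)) 2 P :=
    (memLp_two_iff_integrable_sq (hn.comp hXY).aestronglyMeasurable).2 hintP
  refine ⟨hmem, ?_, ?_⟩
  · have e : ∫ ω, n (X ω, Y ω) ^ 2 ∂P = ∫ s, ∫ z, n (s, z) ^ 2 ∂ν ∂(P.map X) := by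
      rw [← integral_prod _ hint, ← hmap,
        integral_map hXY.aemeasurable hn2.aestronglyMeasurable]
    rw [e]
    calc _ ≤ ∫ _s, v ∂(P.map X) :=
          integral_mono hint.integral_prod_left (integrable_const v) hv
      _ = v := by simp
  · intro ψ hψ hψ2
    have hm : Measurable (fun q : S × Z => ψ q.1 * n q) := (hψ.comp measurable_fst).mul hn
    have hi : Integrable (fun q : S × Z => ψ q.1 * n q) ((P.map X).prod ν) := by
      rw [← hmap, integrable_map_measure hm.aestronglyMeasurable hXY.aemeasurable]
      exact hψ2.integrable_mul hmem
    have e : ∫ ω, ψ (X ω) * n (X ω, Y ω) ∂P = ∫ s, ∫ z, ψ s * n (s, z) ∂ν ∂(P.map X) := by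
      rw [← integral_prod (fun q : S × Z => ψ q.1 * n q) hi, ← hmap,
        integral_map hXY.aemeasurable hm.aestronglyMeasurable]
    rw [e]
    simp [integral_const_mul, h0]

lemma integrable_mul_of_memLp {f g : Ω → ℝ} (hf : MemLp f 2 P) (hg : MemLp g 2 P) :
    Integrable (fun ω => f ω * g ω) P := hf.integrable_mul hg

/-- Integrate `2c|f| ≤ f² + c²`. -/
lemma integral_abs_le_of_integral_sq_le {f : Ω → ℝ} (hf : MemLp f 2 P) {c : ℝ} (hc : 0 < c)
    (h : ∫ ω, f ω ^ 2 ∂P ≤ c ^ 2) : ∫ ω, |f ω| ∂P ≤ c := by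
  have h1 : ∫ ω, 2 * c * |f ω| ∂P ≤ ∫ ω, (f ω ^ 2 + c ^ 2) ∂P := by
    refine integral_mono (((hf.integrable one_le_two).abs).const_mul _)
      (hf.integrable_sq.add (integrable_const _)) fun ω => ?_
    have := sq_nonneg (|f ω| - c)
    have := sq_abs (f ω)
    simp only
    nlinarith
  rw [integral_const_mul, integral_add hf.integrable_sq (integrable_const _)] at h1
  simp only [integral_const, probReal_univ, one_smul] at h1
  nlinarith

end Noise

/-! ### Moments of noise and gradients, and the exponential step along the trajectory. -/

section RandomTrajectory

variable {d : ℕ} {Ω Z : Type*} [MeasurableSpace Ω] [MeasurableSpace Z]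
  {P : Measure Ω} [IsProbabilityMeasure P] {ν : Measure Z} [IsProbabilityMeasure ν]
  {α : ℕ → Ω → ℝ} {r : ℕ → Ω → Z} {F : E d → ℝ} {stoGrad : E d → Z → E d} {G σ : Fin d → ℝ}
  {β D : ℝ} (x₀ : E d)

lemma measurable_past_multiplier (α : ℕ → Ω → ℝ) (r : ℕ → Ω → Z) {t : ℕ} :
    ∀ s ≤ t, Measurable[past α r t] (α s) :=
  fun _ hs => measurable_fst.comp (measurable_past α r hs)

lemma measurable_past_seed (α : ℕ → Ω → ℝ) (r : ℕ → Ω → Z) {t : ℕ} :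
    ∀ s ≤ t, Measurable[past α r t] (r s) :=
  fun _ hs => measurable_snd.comp (measurable_past α r hs)

/-- Testing against functions of both `x_(t+1)` and a past variable `V` covers the two
orthogonalities needed: to `∇F(x_(t+1))`, and to past quantities such as `z_(t+1)` or the
accumulated noise. -/
lemma noise_centred (hF : CoordinateAssumption F stoGrad ν G σ) (hS : IsSampling P ν α r)
    (t : ℕ) (i : Fin d) {V : Ω → ℝ} (hV : Measurable[past α r t] V) :
    MemLp (fun ω => noise β D stoGrad x₀ (α · ω) (r · ω) F (t + 1) i) 2 P ∧
    ∫ ω, noise β D stoGrad x₀ (α · ω) (r · ω) F (t + 1) i ^ 2 ∂P ≤ σ i ^ 2 ∧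
    ∀ ψ : E d × ℝ → ℝ, Measurable ψ →
      MemLp (fun ω => ψ (iter β D stoGrad x₀ (α · ω) (r · ω) (t + 1), V ω)) 2 P →
      ∫ ω, ψ (iter β D stoGrad x₀ (α · ω) (r · ω) (t + 1), V ω) *
        noise β D stoGrad x₀ (α · ω) (r · ω) F (t + 1) i ∂P = 0 := by
  have hW : Measurable[past α r t] (fun ω => (iter β D stoGrad x₀ (α · ω) (r · ω) t,
      incr β D stoGrad x₀ (α · ω) (r · ω) (t + 1), V ω)) := by
    have h1 := @measurable_iter d Z Ω _ (past α r t) β D stoGrad x₀ α r t hF.measurable_stoGrad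
      (measurable_past_multiplier α r) (measurable_past_seed α r)
    have h2 := @measurable_incr_succ d Z Ω _ (past α r t) β D stoGrad x₀ α r t
      hF.measurable_stoGrad (measurable_past_multiplier α r) (measurable_past_seed α r)
    exact h1.prodMk (h2.prodMk hV)
  have hmap := map_past_seed hS hW
  have hX := (hW.mono (past_le hS t) le_rfl).prodMk (hS.measurable_α (t + 1))
  set next : (E d × E d × ℝ) × ℝ → E d := fun q => q.1.1 + q.2 • q.1.2.1 with hnext
  have hnextm : Measurable next := by fun_prop
  set n : ((E d × E d × ℝ) × ℝ) × Z → ℝ :=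
    fun q => stoGrad (next q.1) q.2 i - gradient F (next q.1) i with hn
  have hnm : Measurable n := by
    have h1 : Measurable (fun q : ((E d × E d × ℝ) × ℝ) × Z => stoGrad (next q.1) q.2) :=
      hF.measurable_stoGrad.comp ((hnextm.comp measurable_fst).prodMk measurable_snd)
    have h2 : Measurable (fun q : ((E d × E d × ℝ) × ℝ) × Z => gradient F (next q.1)) :=
      (measurable_gradient F).comp (hnextm.comp measurable_fst)
    exact (((EuclideanSpace.proj (𝕜 := ℝ) i).measurable).comp h1).sub
      (((EuclideanSpace.proj (𝕜 := ℝ) i).measurable).comp h2)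
  have key := conditionally_centred (n := n) (v := σ i ^ 2) hX (hS.measurable_r (t + 1)) hmap hnm
    (fun s => (hF.memLp_stoGrad (next s) i).sub (memLp_const (gradient F (next s) i)))
    (fun s => by
      simp only [hn]
      rw [integral_sub ((hF.memLp_stoGrad _ i).integrable one_le_two) (integrable_const _),
        hF.unbiased]
      simp)
    (fun s => by simpa only [sq_abs] using hF.variance (next s) i)
  have hnoise : ∀ ω, noise β D stoGrad x₀ (α · ω) (r · ω) F (t + 1) i =
      n (((iter β D stoGrad x₀ (α · ω) (r · ω) t, incr β D stoGrad x₀ (α · ω) (r · ω) (t + 1),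
        V ω), α (t + 1) ω), r (t + 1) ω) := by
    intro ω
    simp only [noise, observed_succ, PiLp.sub_apply]
    rfl
  simp_rw [hnoise]
  refine ⟨key.1, key.2.1, fun ψ hψ hψ2 => ?_⟩
  exact key.2.2 (fun q => ψ (next q, q.1.2.2))
    (hψ.comp (hnextm.prodMk (by fun_prop))) hψ2

lemma measurable_apply {f : Ω → E d} (hf : Measurable f) (i : Fin d) :
    Measurable (fun ω => f ω i) :=
  ((EuclideanSpace.proj (𝕜 := ℝ) i).measurable).comp hf

lemma memLp_noise (hF : CoordinateAssumption F stoGrad ν G σ) (hS : IsSampling P ν α r)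
    (t : ℕ) (i : Fin d) :
    MemLp (fun ω => noise β D stoGrad x₀ (α · ω) (r · ω) F t i) 2 P := by
  cases t with
  | zero => simp [noise]
  | succ t => exact (noise_centred x₀ hF hS t i (V := fun _ => 0) measurable_const).1

lemma integral_noise_sq_le (hF : CoordinateAssumption F stoGrad ν G σ)
    (hS : IsSampling P ν α r) (t : ℕ) (i : Fin d) :
    ∫ ω, noise β D stoGrad x₀ (α · ω) (r · ω) F (t + 1) i ^ 2 ∂P ≤ σ i ^ 2 :=
  (noise_centred x₀ hF hS t i (V := fun _ => 0) measurable_const).2.1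

lemma integral_mul_noise (hF : CoordinateAssumption F stoGrad ν G σ)
    (hS : IsSampling P ν α r) (t : ℕ) (i : Fin d) {V : Ω → ℝ} (hV : Measurable[past α r t] V)
    (hV2 : MemLp V 2 P) :
    ∫ ω, V ω * noise β D stoGrad x₀ (α · ω) (r · ω) F (t + 1) i ∂P = 0 :=
  (noise_centred x₀ hF hS t i hV).2.2 (fun q => q.2) measurable_snd hV2

lemma memLp_gradient_iter (hF : CoordinateAssumption F stoGrad ν G σ)
    (hS : IsSampling P ν α r) (t : ℕ) (i : Fin d) :
    MemLp (fun ω => gradient F (iter β D stoGrad x₀ (α · ω) (r · ω) t) i) 2 P :=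
  MemLp.of_bound (measurable_apply ((measurable_gradient F).comp
      (measurable_iter x₀ hF.measurable_stoGrad (fun s _ => hS.measurable_α s)
        (fun s _ => hS.measurable_r s))) i).aestronglyMeasurable (G i)
    (.of_forall fun _ => hF.lipschitz _ i)

lemma integral_gradient_mul_noise (hF : CoordinateAssumption F stoGrad ν G σ)
    (hS : IsSampling P ν α r) (t : ℕ) (i : Fin d) :
    ∫ ω, gradient F (iter β D stoGrad x₀ (α · ω) (r · ω) (t + 1)) i *
      noise β D stoGrad x₀ (α · ω) (r · ω) F (t + 1) i ∂P = 0 :=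
  (noise_centred x₀ hF hS t i (V := fun _ => 0) measurable_const).2.2
    (fun q => gradient F q.1 i)
    (measurable_apply ((measurable_gradient F).comp measurable_fst) i)
    (memLp_gradient_iter x₀ hF hS (t + 1) i)

lemma observed_eq (t : ℕ) (i : Fin d) (ω : Ω) :
    observed β D stoGrad x₀ (α · ω) (r · ω) (t + 1) i =
      gradient F (iter β D stoGrad x₀ (α · ω) (r · ω) (t + 1)) i +
        noise β D stoGrad x₀ (α · ω) (r · ω) F (t + 1) i := by
  simp [noise]

lemma memLp_observed (hF : CoordinateAssumption F stoGrad ν G σ) (hS : IsSampling P ν α r)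
    (t : ℕ) (i : Fin d) :
    MemLp (fun ω => observed β D stoGrad x₀ (α · ω) (r · ω) t i) 2 P := by
  cases t with
  | zero => simp [observed, conversion]
  | succ t =>
    simp_rw [observed_eq (F := F)]
    exact (memLp_gradient_iter x₀ hF hS (t + 1) i).add (memLp_noise x₀ hF hS (t + 1) i)

/-- Noise is orthogonal to the gradient, so the second moment is at most `G² + σ² ≤ (G + σ)²`. -/
lemma integral_observed_sq_le (hF : CoordinateAssumption F stoGrad ν G σ)
    (hS : IsSampling P ν α r) (t : ℕ) (i : Fin d) :
    ∫ ω, observed β D stoGrad x₀ (α · ω) (r · ω) (t + 1) i ^ 2 ∂P ≤ (G i + σ i) ^ 2 := by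
  have h1 := memLp_gradient_iter (β := β) (D := D) x₀ hF hS (t + 1) i
  have h2 := memLp_noise (β := β) (D := D) x₀ hF hS (t + 1) i
  have h3 := integral_gradient_mul_noise (β := β) (D := D) x₀ hF hS t i
  have h4 := integral_noise_sq_le (β := β) (D := D) x₀ hF hS t i
  have h5 : ∫ ω, gradient F (iter β D stoGrad x₀ (α · ω) (r · ω) (t + 1)) i ^ 2 ∂P ≤ G i ^ 2 := by
    calc _ ≤ ∫ _ω, G i ^ 2 ∂P := integral_mono h1.integrable_sq (integrable_const _) fun ω => by
          simp only
          rw [← sq_abs]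
          exact pow_le_pow_left₀ (abs_nonneg _) (hF.lipschitz _ i) 2
      _ = _ := by simp
  have h12 := integrable_mul_of_memLp h1 h2
  have e : ∀ ω, observed β D stoGrad x₀ (α · ω) (r · ω) (t + 1) i ^ 2 =
      gradient F (iter β D stoGrad x₀ (α · ω) (r · ω) (t + 1)) i ^ 2 +
      (2 * (gradient F (iter β D stoGrad x₀ (α · ω) (r · ω) (t + 1)) i *
        noise β D stoGrad x₀ (α · ω) (r · ω) F (t + 1) i) +
      noise β D stoGrad x₀ (α · ω) (r · ω) F (t + 1) i ^ 2) := by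
    intro ω
    rw [observed_eq (F := F)]; ring
  have h6 : Integrable (fun ω => 2 * (gradient F (iter β D stoGrad x₀ (α · ω) (r · ω) (t + 1)) i *
        noise β D stoGrad x₀ (α · ω) (r · ω) F (t + 1) i) +
      noise β D stoGrad x₀ (α · ω) (r · ω) F (t + 1) i ^ 2) P :=
    (h12.const_mul 2).add h2.integrable_sq
  rw [integral_congr_ae (.of_forall e), integral_add h1.integrable_sq h6,
    integral_add (h12.const_mul 2) h2.integrable_sq, integral_const_mul, h3]
  nlinarith [hF.G_pos i, hF.σ_pos i, mul_pos (hF.G_pos i) (hF.σ_pos i)]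

/-- Fresh noise is orthogonal to the accumulated noise, so second moments obey `m_(t+1) ≤ β² m_t +
σ²`; with `β² ≤ β` the bound `σ² / (1 - β)` is preserved. -/
lemma discounted_noise (hF : CoordinateAssumption F stoGrad ν G σ) (hS : IsSampling P ν α r)
    (hβ₀ : 0 ≤ β) (hβ₁ : β < 1) (i : Fin d) (t : ℕ) :
    MemLp (fun ω => discountedSum β
      (fun s => noise β D stoGrad x₀ (α · ω) (r · ω) F s i) t) 2 P ∧
    ∫ ω, discountedSum β (fun s => noise β D stoGrad x₀ (α · ω) (r · ω) F s i) t ^ 2 ∂P ≤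
      σ i ^ 2 / (1 - β) := by
  have hb : 0 < 1 - β := sub_pos.2 hβ₁
  induction t with
  | zero => simpa using by positivity
  | succ t ih =>
    obtain ⟨ih1, ih2⟩ := ih
    simp only [discountedSum_succ, smul_eq_mul]
    have hn := memLp_noise (β := β) (D := D) x₀ hF hS (t + 1) i
    have hN := ih1.const_mul β
    refine ⟨hN.add hn, ?_⟩
    have hmeas : Measurable[past α r t] (fun ω => discountedSum β
        (fun s => noise β D stoGrad x₀ (α · ω) (r · ω) F s i) t) := by
      refine @measurable_discountedSum Ω (past α r t) β _ t fun s hs => ?_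
      refine @measurable_apply d Ω (past α r t) _ ?_ i
      exact @measurable_noise d Z Ω _ (past α r t) β D stoGrad x₀ α r s hF.measurable_stoGrad F
        (fun s' h => measurable_past_multiplier α r s' (h.trans hs))
        (fun s' h => measurable_past_seed α r s' (h.trans hs))
    have horth := integral_mul_noise (β := β) (D := D) x₀ hF hS t i hmeas ih1
    have hsq := integral_noise_sq_le (β := β) (D := D) x₀ hF hS t i
    have e : ∀ ω, (β * discountedSum β (fun s => noise β D stoGrad x₀ (α · ω) (r · ω) F s i) t +
        noise β D stoGrad x₀ (α · ω) (r · ω) F (t + 1) i) ^ 2 =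
        β ^ 2 * discountedSum β (fun s => noise β D stoGrad x₀ (α · ω) (r · ω) F s i) t ^ 2 +
        (2 * β * (discountedSum β (fun s => noise β D stoGrad x₀ (α · ω) (r · ω) F s i) t *
          noise β D stoGrad x₀ (α · ω) (r · ω) F (t + 1) i) +
        noise β D stoGrad x₀ (α · ω) (r · ω) F (t + 1) i ^ 2) := fun ω => by ring
    have h12 := (integrable_mul_of_memLp ih1 hn).const_mul (2 * β)
    have h6 : Integrable (fun ω =>
        2 * β * (discountedSum β (fun s => noise β D stoGrad x₀ (α · ω) (r · ω) F s i) t *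
          noise β D stoGrad x₀ (α · ω) (r · ω) F (t + 1) i) +
        noise β D stoGrad x₀ (α · ω) (r · ω) F (t + 1) i ^ 2) P := h12.add hn.integrable_sq
    rw [integral_congr_ae (.of_forall e), integral_add (ih1.integrable_sq.const_mul _) h6,
      integral_add h12 hn.integrable_sq, integral_const_mul, integral_const_mul, horth]
    have h7 : β ^ 2 * (σ i ^ 2 / (1 - β)) ≤ β * (σ i ^ 2 / (1 - β)) :=
      mul_le_mul_of_nonneg_right (by nlinarith) (by positivity)
    have h8 : σ i ^ 2 / (1 - β) = β * (σ i ^ 2 / (1 - β)) + σ i ^ 2 := by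
      field_simp; ring
    have h9 := mul_le_mul_of_nonneg_left ih2 (sq_nonneg β)
    linarith

lemma integral_abs_discounted_noise_le (hF : CoordinateAssumption F stoGrad ν G σ)
    (hS : IsSampling P ν α r) (hβ₀ : 0 ≤ β) (hβ₁ : β < 1) (i : Fin d) (t : ℕ) :
    ∫ ω, |discountedSum β (fun s => noise β D stoGrad x₀ (α · ω) (r · ω) F s i) t| ∂P ≤
      σ i / √(1 - β) := by
  have hb : 0 < 1 - β := sub_pos.2 hβ₁
  obtain ⟨h1, h2⟩ := discounted_noise (D := D) x₀ hF hS hβ₀ hβ₁ i t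
  refine integral_abs_le_of_integral_sq_le h1 (div_pos (hF.σ_pos i) (Real.sqrt_pos.2 hb)) ?_
  rwa [div_pow, Real.sq_sqrt hb.le]

/-- The squared quantity satisfies the same kind of recursion by definition, with no orthogonality
needed; the first moment follows from the second. -/
lemma discounted_observed (hF : CoordinateAssumption F stoGrad ν G σ) (hS : IsSampling P ν α r)
    (hβ₀ : 0 ≤ β) (hβ₁ : β < 1) (i : Fin d) (t : ℕ) :
    MemLp (fun ω => discountedRss β
      (fun s => observed β D stoGrad x₀ (α · ω) (r · ω) s i) t) 2 P ∧
    ∫ ω, discountedRss β (fun s => observed β D stoGrad x₀ (α · ω) (r · ω) s i) t ∂P ≤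
      (G i + σ i) / √(1 - β) := by
  have hb : 0 < 1 - β := sub_pos.2 hβ₁
  have hmeas : Measurable (fun ω => discountedRss β
      (fun s => observed β D stoGrad x₀ (α · ω) (r · ω) s i) t) :=
    (measurable_discountedSum (β ^ 2) fun s _ => (measurable_apply
      (measurable_observed x₀ hF.measurable_stoGrad (fun s _ => hS.measurable_α s)
        (fun s _ => hS.measurable_r s)) i).pow_const 2).sqrt
  have key : Integrable (fun ω => discountedSum (β ^ 2)
        (fun s => observed β D stoGrad x₀ (α · ω) (r · ω) s i ^ 2) t) P ∧
      ∫ ω, discountedSum (β ^ 2)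
        (fun s => observed β D stoGrad x₀ (α · ω) (r · ω) s i ^ 2) t ∂P ≤
        (G i + σ i) ^ 2 / (1 - β) := by
    clear hmeas
    induction t with
    | zero => simpa using by positivity
    | succ t ih =>
      obtain ⟨ih1, ih2⟩ := ih
      simp only [discountedSum_succ, smul_eq_mul]
      have hg := (memLp_observed (β := β) (D := D) x₀ hF hS (t + 1) i).integrable_sq
      refine ⟨(ih1.const_mul _).add hg, ?_⟩
      rw [integral_add (ih1.const_mul _) hg, integral_const_mul]
      have h6 := integral_observed_sq_le (β := β) (D := D) x₀ hF hS t i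
      have h7 : β ^ 2 * ((G i + σ i) ^ 2 / (1 - β)) ≤ β * ((G i + σ i) ^ 2 / (1 - β)) :=
        mul_le_mul_of_nonneg_right (by nlinarith) (by positivity)
      have h8 : (G i + σ i) ^ 2 / (1 - β) =
          β * ((G i + σ i) ^ 2 / (1 - β)) + (G i + σ i) ^ 2 := by
        field_simp; ring
      have h9 := mul_le_mul_of_nonneg_left ih2 (sq_nonneg β)
      linarith
  simp_rw [← discountedRss_sq] at key
  have hmem := (memLp_two_iff_integrable_sq hmeas.aestronglyMeasurable).2 key.1
  refine ⟨hmem, ?_⟩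
  have h := integral_abs_le_of_integral_sq_le hmem (c := (G i + σ i) / √(1 - β))
    (div_pos (add_pos (hF.G_pos i) (hF.σ_pos i)) (Real.sqrt_pos.2 hb))
    (by rw [div_pow, Real.sq_sqrt hb.le]; exact key.2)
  simpa only [abs_of_nonneg (discountedRss_nonneg _ _ _)] using h

lemma memLp_incr (hF : CoordinateAssumption F stoGrad ν G σ) (hS : IsSampling P ν α r)
    (hD : 0 < D) (t : ℕ) (i : Fin d) :
    MemLp (fun ω => incr β D stoGrad x₀ (α · ω) (r · ω) t i) 2 P := by
  refine MemLp.of_bound ?_ D (.of_forall fun ω => abs_incr_le β stoGrad x₀ _ _ hD t i)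
  cases t with
  | zero => simpa [incr] using aestronglyMeasurable_const
  | succ t =>
    exact (measurable_apply (measurable_incr_succ x₀ hF.measurable_stoGrad
      (fun s _ => hS.measurable_α s) (fun s _ => hS.measurable_r s)) i).aestronglyMeasurable

/-- The noise at time `t + 1` is orthogonal to the predictable `z_(t+1)`. -/
lemma integral_observed_mul_incr (hF : CoordinateAssumption F stoGrad ν G σ)
    (hS : IsSampling P ν α r) (hD : 0 < D) (t : ℕ) (i : Fin d) :
    ∫ ω, observed β D stoGrad x₀ (α · ω) (r · ω) (t + 1) i *
      incr β D stoGrad x₀ (α · ω) (r · ω) (t + 1) i ∂P =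
    ∫ ω, gradient F (iter β D stoGrad x₀ (α · ω) (r · ω) (t + 1)) i *
      incr β D stoGrad x₀ (α · ω) (r · ω) (t + 1) i ∂P := by
  have hz := memLp_incr (β := β) x₀ hF hS hD (t + 1) i
  have hmeas : Measurable[past α r t]
      (fun ω => incr β D stoGrad x₀ (α · ω) (r · ω) (t + 1) i) :=
    @measurable_apply d Ω (past α r t) _
      (@measurable_incr_succ d Z Ω _ (past α r t) β D stoGrad x₀ α r t hF.measurable_stoGrad
        (measurable_past_multiplier α r) (measurable_past_seed α r)) i
  have horth := integral_mul_noise (β := β) (D := D) x₀ hF hS t i hmeas hz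
  have e : ∀ ω, observed β D stoGrad x₀ (α · ω) (r · ω) (t + 1) i *
      incr β D stoGrad x₀ (α · ω) (r · ω) (t + 1) i =
      gradient F (iter β D stoGrad x₀ (α · ω) (r · ω) (t + 1)) i *
        incr β D stoGrad x₀ (α · ω) (r · ω) (t + 1) i +
      incr β D stoGrad x₀ (α · ω) (r · ω) (t + 1) i *
        noise β D stoGrad x₀ (α · ω) (r · ω) F (t + 1) i := fun ω => by
    rw [observed_eq (F := F)]; ring
  rw [integral_congr_ae (.of_forall e),
    integral_add (integrable_mul_of_memLp (memLp_gradient_iter x₀ hF hS (t + 1) i) hz)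
      (integrable_mul_of_memLp hz (memLp_noise x₀ hF hS (t + 1) i)), horth, add_zero]

lemma memLp_multiplier (hS : IsSampling P ν α r) (t : ℕ) : MemLp (α t) 2 P := by
  rw [memLp_two_iff_integrable_sq (hS.measurable_α t).aestronglyMeasurable]
  have h := integrable_pow_expMeasure_one 2
  rw [← map_multiplier hS t, integrable_map_measure (by fun_prop)
    (hS.measurable_α t).aemeasurable] at h
  exact h

lemma integral_multiplier_sq (hS : IsSampling P ν α r) (t : ℕ) : ∫ ω, α t ω ^ 2 ∂P = 2 := by
  rw [← integral_sq_expMeasure_one, ← map_multiplier hS t,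
    integral_map (hS.measurable_α t).aemeasurable (by fun_prop)]

lemma abs_sub_le_of_gradient_bounded (hF : CoordinateAssumption F stoGrad ν G σ) (x y : E d) :
    |F y - F x| ≤ l1Norm G * ‖y - x‖ := by
  refine Convex.norm_image_sub_le_of_norm_fderiv_le (𝕜 := ℝ) (s := Set.univ)
    (fun x _ => hF.differentiable x) (fun x _ => ?_) convex_univ (Set.mem_univ _) (Set.mem_univ _)
  refine le_trans (le_of_eq ?_) (norm_gradient_le hF.lipschitz x)
  unfold gradient
  exact ((InnerProductSpace.toDual ℝ (E d)).symm.norm_map _).symm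

lemma integrable_increment (hF : CoordinateAssumption F stoGrad ν G σ)
    (hS : IsSampling P ν α r) (hD : 0 < D) (t : ℕ) :
    Integrable (fun ω => F (iter β D stoGrad x₀ (α · ω) (r · ω) (t + 1)) -
      F (iter β D stoGrad x₀ (α · ω) (r · ω) t)) P := by
  have hm : ∀ t, Measurable (fun ω => F (iter β D stoGrad x₀ (α · ω) (r · ω) t)) := fun t =>
    hF.differentiable.continuous.measurable.comp
      (measurable_iter x₀ hF.measurable_stoGrad (fun s _ => hS.measurable_α s)
        (fun s _ => hS.measurable_r s))
  have hi := ((memLp_multiplier hS (t + 1)).integrable one_le_two).abs.const_mul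
    (l1Norm G * √(d * D ^ 2))
  refine hi.mono' ((hm (t + 1)).sub (hm t)).aestronglyMeasurable (.of_forall fun ω => ?_)
  refine (abs_sub_le_of_gradient_bounded hF _ _).trans ?_
  rw [iter_succ, add_sub_cancel_left, norm_smul, Real.norm_eq_abs, mul_assoc,
    mul_comm (|α (t + 1) ω|)]
  refine mul_le_mul_of_nonneg_left ?_ (l1Norm_nonneg _)
  exact mul_le_mul_of_nonneg_right
    (Real.le_sqrt_of_sq_le (norm_incr_sq_le β stoGrad x₀ _ _ hD _)) (abs_nonneg _)

lemma integrable_value (hF : CoordinateAssumption F stoGrad ν G σ)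
    (hS : IsSampling P ν α r) (hD : 0 < D) (t : ℕ) :
    Integrable (fun ω => F (iter β D stoGrad x₀ (α · ω) (r · ω) t)) P := by
  induction t with
  | zero => exact integrable_const (F x₀)
  | succ t ih =>
    refine ((integrable_increment (β := β) x₀ hF hS hD t).add ih).congr (.of_forall fun ω => ?_)
    simp

lemma inner_eq_sum (x y : E d) : inner ℝ x y = ∑ i, x i * y i := by
  rw [PiLp.inner_apply]
  exact Finset.sum_congr rfl fun i _ => by simp [mul_comm]

/-- An exponential step along an independent direction turns the function difference into a
linear functional of the gradient at the new point. -/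
lemma integral_exponential_step (hF : CoordinateAssumption F stoGrad ν G σ) {W : Ω → E d × E d}
    {a : Ω → ℝ} (hW : Measurable W) (ha : Measurable a)
    (hmap : P.map (fun ω => (W ω, a ω)) = (P.map W).prod (expMeasure 1))
    (hi₁ : Integrable (fun ω => F ((W ω).1 + a ω • (W ω).2) - F (W ω).1) P)
    (hi₂ : Integrable
      (fun ω => inner ℝ (gradient F ((W ω).1 + a ω • (W ω).2)) (W ω).2) P) :
    ∫ ω, (F ((W ω).1 + a ω • (W ω).2) - F (W ω).1) ∂P =
      ∫ ω, inner ℝ (gradient F ((W ω).1 + a ω • (W ω).2)) (W ω).2 ∂P := by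
  have : IsProbabilityMeasure (expMeasure 1) := isProbabilityMeasure_expMeasure one_pos
  have hX := hW.prodMk ha
  have hFm : Measurable F := hF.differentiable.continuous.measurable
  set f₁ : (E d × E d) × ℝ → ℝ := fun q => F (q.1.1 + q.2 • q.1.2) - F q.1.1 with hf₁
  set f₂ : (E d × E d) × ℝ → ℝ := fun q =>
    inner ℝ (gradient F (q.1.1 + q.2 • q.1.2)) q.1.2 with hf₂
  have hm1 : Measurable f₁ := (hFm.comp (by fun_prop)).sub (hFm.comp (by fun_prop))
  have hm2 : Measurable f₂ :=
    ((measurable_gradient F).comp (by fun_prop)).inner (by fun_prop)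
  have hi1 : Integrable f₁ ((P.map W).prod (expMeasure 1)) := by
    rw [← hmap, integrable_map_measure hm1.aestronglyMeasurable hX.aemeasurable]
    exact hi₁
  have hi2 : Integrable f₂ ((P.map W).prod (expMeasure 1)) := by
    rw [← hmap, integrable_map_measure hm2.aestronglyMeasurable hX.aemeasurable]
    exact hi₂
  change ∫ ω, f₁ (W ω, a ω) ∂P = ∫ ω, f₂ (W ω, a ω) ∂P
  rw [← integral_map hX.aemeasurable hm1.aestronglyMeasurable,
    ← integral_map hX.aemeasurable hm2.aestronglyMeasurable, hmap, integral_prod _ hi1,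
    integral_prod _ hi2]
  -- For a frozen pair `(x, z)` this is the one-dimensional identity along `a ↦ F(x + a z)`.
  refine integral_congr_ae (.of_forall fun w => ?_)
  have hd : ∀ a : ℝ, HasDerivAt (fun a : ℝ => F (w.1 + a • w.2)) (f₂ (w, a)) a := by
    intro a
    have h1 := (hF.differentiable (w.1 + a • w.2)).hasGradientAt.hasFDerivAt
    have h2 : HasDerivAt (fun a : ℝ => w.1 + a • w.2) w.2 a := by
      simpa using ((hasDerivAt_id a).smul_const w.2).const_add w.1
    exact h1.comp_hasDerivAt a h2
  have := integral_sub_eq_integral_deriv_expMeasure (M := l1Norm G * ‖w.2‖) hd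
    (hm2.comp (measurable_const.prodMk measurable_id))
    (fun a => (abs_real_inner_le_norm _ _).trans
      (mul_le_mul_of_nonneg_right (norm_gradient_le hF.lipschitz _) (norm_nonneg _)))
  simpa [hf₁] using this

/-- The exponential step size turns the function decrease into a linear loss. -/
lemma integral_increment_eq (hF : CoordinateAssumption F stoGrad ν G σ)
    (hS : IsSampling P ν α r) (hD : 0 < D) (t : ℕ) :
    ∫ ω, (F (iter β D stoGrad x₀ (α · ω) (r · ω) (t + 1)) -
      F (iter β D stoGrad x₀ (α · ω) (r · ω) t)) ∂P =
    ∑ i, ∫ ω, gradient F (iter β D stoGrad x₀ (α · ω) (r · ω) (t + 1)) i *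
      incr β D stoGrad x₀ (α · ω) (r · ω) (t + 1) i ∂P := by
  have hint : ∀ i, Integrable (fun ω => gradient F (iter β D stoGrad x₀ (α · ω) (r · ω) (t + 1)) i *
      incr β D stoGrad x₀ (α · ω) (r · ω) (t + 1) i) P := fun i =>
    integrable_mul_of_memLp (memLp_gradient_iter x₀ hF hS (t + 1) i)
      (memLp_incr x₀ hF hS hD (t + 1) i)
  have hint' := integrable_finsetSum Finset.univ fun i _ => hint i
  rw [← integral_finsetSum _ fun i _ => hint i]
  simp_rw [← inner_eq_sum] at hint' ⊢
  have hW : Measurable[past α r t] (fun ω => (iter β D stoGrad x₀ (α · ω) (r · ω) t,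
      incr β D stoGrad x₀ (α · ω) (r · ω) (t + 1))) := by
    have h1 := @measurable_iter d Z Ω _ (past α r t) β D stoGrad x₀ α r t hF.measurable_stoGrad
      (measurable_past_multiplier α r) (measurable_past_seed α r)
    have h2 := @measurable_incr_succ d Z Ω _ (past α r t) β D stoGrad x₀ α r t
      hF.measurable_stoGrad (measurable_past_multiplier α r) (measurable_past_seed α r)
    exact h1.prodMk h2
  exact integral_exponential_step hF (hW.mono (past_le hS t) le_rfl) (hS.measurable_α (t + 1))
    (map_past_multiplier hS hW) (integrable_increment x₀ hF hS hD t) hint'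

end RandomTrajectory

/-! ### Expected bounds at one time and averaged over time. -/

section Expectation

lemma integral_discountedSum {Ω : Type*} [MeasurableSpace Ω] {P : Measure Ω} (β : ℝ)
    {c : ℕ → Ω → ℝ} {t : ℕ} (h : ∀ s, 1 ≤ s → s ≤ t → Integrable (c s) P) :
    Integrable (fun ω => discountedSum β (c · ω) t) P ∧
      ∫ ω, discountedSum β (c · ω) t ∂P = discountedSum β (fun s => ∫ ω, c s ω ∂P) t := by
  have h' : ∀ s ∈ Finset.Icc 1 t, Integrable (fun ω => β ^ (t - s) • c s ω) P := fun s hs =>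
    (h s (Finset.mem_Icc.1 hs).1 (Finset.mem_Icc.1 hs).2).smul (β ^ (t - s))
  unfold discountedSum
  refine ⟨integrable_finsetSum _ h', ?_⟩
  rw [integral_finsetSum _ h']
  exact Finset.sum_congr rfl fun s _ => integral_smul _ _

variable {d : ℕ} {Ω Z : Type*} [MeasurableSpace Ω] [MeasurableSpace Z]
  {P : Measure Ω} [IsProbabilityMeasure P] {ν : Measure Z} [IsProbabilityMeasure ν]
  {α : ℕ → Ω → ℝ} {r : ℕ → Ω → Z} {F : E d → ℝ} {stoGrad : E d → Z → E d} {G σ : Fin d → ℝ}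
  {β D : ℝ} (x₀ : E d)

/-- As `E α² = 2`, the delay `t - s` contributes `2 (t - s)²`; the squared-delay bound supplies
another factor 2, whence the 4. -/
lemma integral_spread (hS : IsSampling P ν α r) (hβ₀ : 0 ≤ β) (hβ₁ : β < 1) {t : ℕ}
    (ht : 1 ≤ t) :
    Integrable (fun ω => spread β (α · ω) t) P ∧
      (1 - β) / (1 - β ^ t) * ∫ ω, spread β (α · ω) t ∂P ≤ 4 / (1 - β) ^ 2 := by
  have hb : 0 < 1 - β := sub_pos.2 hβ₁
  have hbt : 0 < 1 - β ^ t := sub_pos.2 (pow_lt_one₀ hβ₀ hβ₁ (by omega))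
  have hsq : ∀ k, Integrable (fun ω => α k ω ^ 2) P := fun k => (memLp_multiplier hS k).integrable_sq
  have h := integral_discountedSum (P := P) β (t := t)
    (c := fun s ω => ((t - s : ℕ) : ℝ) * ∑ k ∈ Finset.Ioc s t, α k ω ^ 2)
    (fun s _ _ => (integrable_finsetSum _ fun k _ => hsq k).const_mul _)
  refine ⟨h.1, ?_⟩
  have e : ∫ ω, spread β (α · ω) t ∂P =
      2 * discountedSum β (fun s => ((t - s : ℕ) : ℝ) ^ 2) t := by
    refine h.2.trans ?_
    unfold discountedSum
    rw [Finset.mul_sum]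
    refine Finset.sum_congr rfl fun s _ => ?_
    beta_reduce
    rw [integral_const_mul, integral_finsetSum _ fun k _ => hsq k,
      Finset.sum_congr rfl fun k _ => integral_multiplier_sq hS k]
    simp only [Finset.sum_const, Nat.card_Ioc, nsmul_eq_mul, smul_eq_mul]
    ring
  have h1 := discountedSum_sq_delay_le hβ₀ hβ₁.le t
  have h2 := discountedSum_const_one β t
  rw [e, div_mul_eq_mul_div, div_le_div_iff₀ hbt (by positivity)]
  nlinarith [mul_le_mul_of_nonneg_left h1 hb.le]

/-- Unbiasedness turns observed into true gradients, and the exponential step turns the resulting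
inner products into changes of `E F`. -/
lemma integral_sum_linear_loss (hF : CoordinateAssumption F stoGrad ν G σ)
    (hS : IsSampling P ν α r) (hD : 0 < D) (t : ℕ) :
    (∀ i, Integrable (fun ω => discountedSum β (fun s =>
      observed β D stoGrad x₀ (α · ω) (r · ω) s i *
        incr β D stoGrad x₀ (α · ω) (r · ω) s i) t) P) ∧
    ∑ i, ∫ ω, discountedSum β (fun s => observed β D stoGrad x₀ (α · ω) (r · ω) s i *
        incr β D stoGrad x₀ (α · ω) (r · ω) s i) t ∂P =
      discountedSum β (fun s => (∫ ω, F (iter β D stoGrad x₀ (α · ω) (r · ω) s) ∂P) -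
        ∫ ω, F (iter β D stoGrad x₀ (α · ω) (r · ω) (s - 1)) ∂P) t := by
  have h : ∀ i, _ := fun i => integral_discountedSum (P := P) β (t := t)
    (c := fun s ω => observed β D stoGrad x₀ (α · ω) (r · ω) s i *
        incr β D stoGrad x₀ (α · ω) (r · ω) s i)
    (fun s _ _ => integrable_mul_of_memLp (memLp_observed x₀ hF hS s i)
      (memLp_incr x₀ hF hS hD s i))
  refine ⟨fun i => (h i).1, ?_⟩
  rw [Finset.sum_congr rfl fun i _ => (h i).2, ← discountedSum_sum]
  refine discountedSum_congr fun s hs _ => ?_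
  obtain ⟨s, rfl⟩ := Nat.exists_eq_add_of_le' hs
  rw [Finset.sum_congr rfl fun i _ => integral_observed_mul_incr x₀ hF hS hD s i,
    ← integral_increment_eq x₀ hF hS hD s, Nat.add_sub_cancel]
  exact integral_sub (integrable_value x₀ hF hS hD (s + 1)) (integrable_value x₀ hF hS hD s)

lemma measurable_ema {x : ℕ → Ω → E d} (hx : ∀ t, Measurable (x t)) (t : ℕ) :
    Measurable (fun ω => ema β (x · ω) t) := by
  induction t with
  | zero => exact hx 0
  | succ t ih => 
    exact (ih.const_smul ((β - β ^ (t + 1)) / (1 - β ^ (t + 1)))).add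
      ((hx (t + 1)).const_smul ((1 - β) / (1 - β ^ (t + 1))))

lemma integrable_regNorm₁_adamEMA (hF : CoordinateAssumption F stoGrad ν G σ)
    (hS : IsSampling P ν α r) {lam : ℝ} (hlam : 0 ≤ lam) (t : ℕ) :
    Integrable (fun ω => regNorm₁ lam F (adamEMA β D stoGrad x₀ (α · ω) (r · ω) t)) P := by
  have hm : Measurable (fun ω => adamEMA β D stoGrad x₀ (α · ω) (r · ω) t) :=
    measurable_ema (fun s => measurable_iter x₀ hF.measurable_stoGrad
      (fun s _ => hS.measurable_α s) (fun s _ => hS.measurable_r s)) t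
  refine (integrable_const (l1Norm G)).mono'
    ((continuous_regNorm₁ hF.lipschitz hlam).measurable.comp hm).aestronglyMeasurable
    (.of_forall fun ω => ?_)
  rw [Real.norm_of_nonneg (regNorm₁_nonneg hlam _)]
  exact regNorm₁_le_l1Norm hF.lipschitz hlam _

/-- Expectation of the pathwise bound. The constant `9/2` is `1` from the noise plus `7/2` from the
regret, using `σ i ≤ G i + σ i`. -/
lemma integral_regNorm₁_adamEMA_le (hF : CoordinateAssumption F stoGrad ν G σ)
    (hS : IsSampling P ν α r) {lam : ℝ} (hlam : 0 ≤ lam) (hβ₀ : 0 < β) (hβ₁ : β < 1)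
    (hD : 0 < D) {t : ℕ} (ht : 1 ≤ t) :
    ∫ ω, regNorm₁ lam F (adamEMA β D stoGrad x₀ (α · ω) (r · ω) t) ∂P ≤
      9 / 2 * √(1 - β) * l1Norm (fun i => G i + σ i) + β ^ t * l1Norm G +
      lam * (d * D ^ 2) * (4 / (1 - β) ^ 2) +
      (1 - β) / D * discountedSum β
        (fun s => (∫ ω, F (iter β D stoGrad x₀ (α · ω) (r · ω) (s - 1)) ∂P) -
          ∫ ω, F (iter β D stoGrad x₀ (α · ω) (r · ω) s) ∂P) t := by
  have hb : 0 < 1 - β := sub_pos.2 hβ₁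
  obtain ⟨hsp, hsp'⟩ := integral_spread hS hβ₀.le hβ₁ ht
  obtain ⟨hlin, hlin'⟩ := integral_sum_linear_loss (β := β) x₀ hF hS hD t
  have hN : ∀ i, Integrable (fun ω => D * |discountedSum β
      (fun s => noise β D stoGrad x₀ (α · ω) (r · ω) F s i) t|) P := fun i =>
    (((discounted_noise x₀ hF hS hβ₀.le hβ₁ i t).1.integrable one_le_two).abs).const_mul D
  have hq : ∀ i, Integrable (fun ω => 7 / 2 * D * discountedRss β
      (fun s => observed β D stoGrad x₀ (α · ω) (r · ω) s i) t) P := fun i =>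
    ((discounted_observed x₀ hF hS hβ₀.le hβ₁ i t).1.integrable one_le_two).const_mul _
  have hNq : ∀ i, Integrable (fun ω => D * |discountedSum β
      (fun s => noise β D stoGrad x₀ (α · ω) (r · ω) F s i) t| + 7 / 2 * D * discountedRss β
      (fun s => observed β D stoGrad x₀ (α · ω) (r · ω) s i) t) P := fun i => (hN i).add (hq i)
  have hterm : ∀ i, Integrable (fun ω => D * |discountedSum β
      (fun s => noise β D stoGrad x₀ (α · ω) (r · ω) F s i) t| + 7 / 2 * D * discountedRss β
      (fun s => observed β D stoGrad x₀ (α · ω) (r · ω) s i) t -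
      discountedSum β (fun s => observed β D stoGrad x₀ (α · ω) (r · ω) s i *
        incr β D stoGrad x₀ (α · ω) (r · ω) s i) t) P := fun i => (hNq i).sub (hlin i)
  set U : Ω → ℝ := fun ω => ∑ i, (D * |discountedSum β
      (fun s => noise β D stoGrad x₀ (α · ω) (r · ω) F s i) t| + 7 / 2 * D * discountedRss β
      (fun s => observed β D stoGrad x₀ (α · ω) (r · ω) s i) t -
      discountedSum β (fun s => observed β D stoGrad x₀ (α · ω) (r · ω) s i *
        incr β D stoGrad x₀ (α · ω) (r · ω) s i) t) with hU
  have hUi : Integrable U P := integrable_finsetSum _ fun i _ => hterm i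
  have hUint : ∫ ω, U ω ∂P ≤ 9 / 2 * D * (l1Norm (fun i => G i + σ i) / √(1 - β)) +
      discountedSum β
        (fun s => (∫ ω, F (iter β D stoGrad x₀ (α · ω) (r · ω) (s - 1)) ∂P) -
          ∫ ω, F (iter β D stoGrad x₀ (α · ω) (r · ω) s) ∂P) t := by
    rw [hU, integral_finsetSum _ fun i _ => hterm i,
      Finset.sum_congr rfl fun i _ => integral_sub (hNq i) (hlin i), Finset.sum_sub_distrib, hlin',
      discountedSum_sub, discountedSum_sub]
    have hsum : ∑ i, ∫ ω, (D * |discountedSum β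
        (fun s => noise β D stoGrad x₀ (α · ω) (r · ω) F s i) t| + 7 / 2 * D * discountedRss β
        (fun s => observed β D stoGrad x₀ (α · ω) (r · ω) s i) t) ∂P ≤
        9 / 2 * D * (l1Norm (fun i => G i + σ i) / √(1 - β)) := by
      unfold l1Norm
      rw [Finset.sum_div, Finset.mul_sum]
      refine Finset.sum_le_sum fun i _ => ?_
      rw [integral_add (hN i) (hq i), integral_const_mul, integral_const_mul,
        abs_of_pos (add_pos (hF.G_pos i) (hF.σ_pos i))]
      have h1 := integral_abs_discounted_noise_le (D := D) x₀ hF hS hβ₀.le hβ₁ i t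
      have h2 := (discounted_observed (D := D) x₀ hF hS hβ₀.le hβ₁ i t).2
      have h3 : σ i / √(1 - β) ≤ (G i + σ i) / √(1 - β) := by
        gcongr
        linarith [hF.G_pos i]
      have h4 := mul_le_mul_of_nonneg_left (h1.trans h3) hD.le
      have h5 := mul_le_mul_of_nonneg_left h2 (by positivity : 0 ≤ 7 / 2 * D)
      linarith
    linarith
  have hbound : ∀ ω, regNorm₁ lam F (adamEMA β D stoGrad x₀ (α · ω) (r · ω) t) ≤
      (1 - β) / D * U ω + (β ^ t * l1Norm G +
        lam * (d * D ^ 2) * ((1 - β) / (1 - β ^ t)) * spread β (α · ω) t) := by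
    intro ω
    refine (regNorm₁_ema_le stoGrad x₀ (α · ω) (r · ω) hF.lipschitz hlam hβ₀.le hβ₁ hD
      ht).trans ?_
    have h1 := sum_abs_discountedSum_gradient_le stoGrad x₀ (α · ω) (r · ω) F hβ₀ hD t
    have h2 := mul_le_mul_of_nonneg_left h1 (div_pos hb hD).le
    rw [← mul_assoc, div_mul_cancel₀ _ hD.ne'] at h2
    linarith
  have hi1 : Integrable (fun ω => (1 - β) / D * U ω) P := hUi.const_mul _
  have hi2 : Integrable (fun ω => lam * (d * D ^ 2) * ((1 - β) / (1 - β ^ t)) *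
      spread β (α · ω) t) P := hsp.const_mul _
  have hi3 : Integrable (fun ω => β ^ t * l1Norm G +
      lam * (d * D ^ 2) * ((1 - β) / (1 - β ^ t)) * spread β (α · ω) t) P :=
    (integrable_const _).add hi2
  have hmono := integral_mono (integrable_regNorm₁_adamEMA x₀ hF hS hlam t) (hi1.add hi3) hbound
  refine hmono.trans ?_
  rw [integral_add' hi1 hi3, integral_add (integrable_const _) hi2, integral_const_mul,
    integral_const, probReal_univ, one_smul, integral_const_mul]
  have h1 := mul_le_mul_of_nonneg_left hUint (div_pos hb hD).le
  have h2 := mul_le_mul_of_nonneg_left hsp' (by positivity : 0 ≤ lam * (d * D ^ 2))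
  have h3 : (1 - β) / D * (9 / 2 * D * (l1Norm (fun i => G i + σ i) / √(1 - β))) =
      9 / 2 * √(1 - β) * l1Norm (fun i => G i + σ i) := by
    calc _ = 9 / 2 * ((1 - β) / √(1 - β)) * l1Norm (fun i => G i + σ i) := by field_simp
      _ = _ := by rw [Real.div_sqrt]
  rw [mul_add] at h1
  linarith

/-- The average over time of the expected regularized gradient norm, for general parameters. -/
lemma sum_integral_regNorm₁_adamEMA_le (hF : CoordinateAssumption F stoGrad ν G σ)
    (hS : IsSampling P ν α r) {lam : ℝ} (hlam : 0 ≤ lam) (hβ₀ : 0 < β) (hβ₁ : β < 1)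
    (hD : 0 < D) (T : ℕ) :
    ∑ t ∈ Finset.Icc 1 T,
      ∫ ω, regNorm₁ lam F (adamEMA β D stoGrad x₀ (α · ω) (r · ω) t) ∂P ≤
      T * (9 / 2 * √(1 - β) * l1Norm (fun i => G i + σ i) +
        lam * (d * D ^ 2) * (4 / (1 - β) ^ 2)) +
      l1Norm G / (1 - β) + (F x₀ - ⨅ x, F x) / D := by
  have hb : 0 < 1 - β := sub_pos.2 hβ₁
  -- Subtracting the infimum leaves the decrements unchanged and makes the sequence nonnegative, as
  -- the telescoping bound requires.
  set a : ℕ → ℝ := fun s =>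
    (∫ ω, F (iter β D stoGrad x₀ (α · ω) (r · ω) s) ∂P) - ⨅ x, F x with ha
  have ha0 : ∀ s, 0 ≤ a s := by
    intro s
    have h := integral_mono (μ := P) (integrable_const (⨅ x, F x))
      (integrable_value (β := β) x₀ hF hS hD s) fun ω => ciInf_le hF.bddBelow _
    simp only [integral_const, probReal_univ, one_smul] at h
    exact sub_nonneg.2 h
  have ha_start : a 0 = F x₀ - ⨅ x, F x := by
    simp [ha, iter, conversion]
  have habel := sum_discountedSum_decrements_le hβ₀.le hβ₁.le ha0 T
  have hgeom : ∑ t ∈ Finset.Icc 1 T, β ^ t ≤ 1 / (1 - β) := by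
    rw [le_div_iff₀' hb]
    have : ∀ T : ℕ, (1 - β) * ∑ t ∈ Finset.Icc 1 T, β ^ t = β - β ^ (T + 1) := by
      intro T
      induction T with
      | zero => simp
      | succ T ih =>
        rw [Finset.sum_Icc_succ_top (by omega), mul_add, ih]
        ring
    rw [this]
    linarith [pow_pos hβ₀ (T + 1)]
  calc _ ≤ ∑ t ∈ Finset.Icc 1 T, ((9 / 2 * √(1 - β) * l1Norm (fun i => G i + σ i) +
        lam * (d * D ^ 2) * (4 / (1 - β) ^ 2)) + β ^ t * l1Norm G +
        (1 / D) * ((1 - β) * discountedSum β (fun s => a (s - 1) - a s) t)) := by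
        refine Finset.sum_le_sum fun t ht => ?_
        refine (integral_regNorm₁_adamEMA_le x₀ hF hS hlam hβ₀ hβ₁ hD
          (Finset.mem_Icc.1 ht).1).trans (le_of_eq ?_)
        simp only [ha, sub_sub_sub_cancel_right]
        ring
    _ = T * (9 / 2 * √(1 - β) * l1Norm (fun i => G i + σ i) +
        lam * (d * D ^ 2) * (4 / (1 - β) ^ 2)) + (∑ t ∈ Finset.Icc 1 T, β ^ t) * l1Norm G +
        (1 / D) * ((1 - β) * ∑ t ∈ Finset.Icc 1 T,
          discountedSum β (fun s => a (s - 1) - a s) t) := by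
        rw [Finset.sum_add_distrib, Finset.sum_add_distrib, ← Finset.sum_mul, ← Finset.mul_sum,
          ← Finset.mul_sum]
        simp [mul_add]
    _ ≤ _ := by
        have h1 := mul_le_mul_of_nonneg_right hgeom (l1Norm_nonneg G)
        have h2 := mul_le_mul_of_nonneg_left habel (by positivity : 0 ≤ 1 / D)
        rw [ha_start] at h2
        rw [one_div_mul_eq_div] at h1
        rw [one_div_mul_eq_div D (F x₀ - ⨅ x, F x)] at h2
        linarith

end Expectation

end ClippedAdam

end

/-! ### Substitution of the parameters. -/

open ClippedAdam in
theorem mainTheorem2 {d : ℕ} (hd : 0 < d)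
    {Z : Type*} [MeasurableSpace Z] (ν : Measure Z) [IsProbabilityMeasure ν]
    (F : E d → ℝ) (stoGrad : E d → Z → E d) (G σ : Fin d → ℝ)
    (hF : CoordinateAssumption F stoGrad ν G σ)
    {Ω : Type*} [MeasurableSpace Ω] (P : Measure Ω) [IsProbabilityMeasure P]
    (α : ℕ → Ω → ℝ) (r : ℕ → Ω → Z) (hS : IsSampling P ν α r)
    (x₀ : E d) (lam C ε : ℝ) (hlam : 0 < lam) (hC : 0 < C) (hε : 0 < ε) (hεC : ε < 10 * C)
    (Δ β D : ℝ) (T : ℕ)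
    (hΔ : Δ = F x₀ - ⨅ x, F x)
    (hβ : β = 1 - (ε / (10 * C)) ^ 2)
    (hD : D = (1 - β) * ε ^ (1 / 2 : ℝ) / (4 * (d : ℝ) ^ (1 / 2 : ℝ) * lam ^ (1 / 2 : ℝ)))
    (hT : T = ⌈1 / (1 - β) *
      max (4 * Δ * (d : ℝ) ^ (1 / 2 : ℝ) * lam ^ (1 / 2 : ℝ) / ε ^ (3 / 2 : ℝ)) (12 * C / ε)⌉₊) :
    (∀ t ∈ Finset.Icc 1 T, Integrable
      (fun ω => regNorm₁ lam F (adamEMA β D stoGrad x₀ (fun s => α s ω) (fun s => r s ω) t)) P) ∧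
    (1 / (T : ℝ)) * ∑ t ∈ Finset.Icc 1 T,
      ∫ ω, regNorm₁ lam F (adamEMA β D stoGrad x₀ (fun s => α s ω) (fun s => r s ω) t) ∂P
      ≤ (2 + l1Norm (fun i => G i + σ i) / C) * ε := by
  refine ⟨fun t _ => integrable_regNorm₁_adamEMA x₀ hF hS hlam.le t, ?_⟩
  have hx0 : 0 < ε / (10 * C) := by positivity
  have hx1 : ε / (10 * C) < 1 := (div_lt_one (by positivity)).2 hεC
  have hβ₁ : β < 1 := by rw [hβ]; linarith [pow_pos hx0 2]
  have hβ₀ : 0 < β := by rw [hβ]; nlinarith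
  have hb : 0 < 1 - β := sub_pos.2 hβ₁
  have hsqrt : √(1 - β) = ε / (10 * C) := by
    rw [hβ, sub_sub_cancel, Real.sqrt_sq hx0.le]
  have hd' : (0 : ℝ) < d := Nat.cast_pos.2 hd
  have hε32 : ε ^ (3 / 2 : ℝ) = ε * √ε := by
    rw [show (3 / 2 : ℝ) = 1 + 1 / 2 by norm_num, Real.rpow_add hε, Real.rpow_one,
      Real.sqrt_eq_rpow]
  rw [← Real.sqrt_eq_rpow, ← Real.sqrt_eq_rpow, ← Real.sqrt_eq_rpow] at hD
  rw [hε32, ← Real.sqrt_eq_rpow, ← Real.sqrt_eq_rpow] at hT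
  have hsε := Real.sqrt_pos.2 hε
  have hsd := Real.sqrt_pos.2 hd'
  have hsl := Real.sqrt_pos.2 hlam
  have hsε2 := Real.sq_sqrt hε.le
  have hsd2 := Real.sq_sqrt hd'.le
  have hsl2 := Real.sq_sqrt hlam.le
  have hDpos : 0 < D := by rw [hD]; positivity
  have hTle : max (4 * Δ * √d * √lam / (ε * √ε)) (12 * C / ε) ≤ (1 - β) * T := by
    have h := Nat.le_ceil (1 / (1 - β) * max (4 * Δ * √d * √lam / (ε * √ε)) (12 * C / ε))
    rw [← hT, one_div_mul_eq_div, div_le_iff₀' hb] at h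
    exact h
  have hT1 := (le_max_left _ _).trans hTle
  have hT2 := (le_max_right _ _).trans hTle
  have hTpos : (0 : ℝ) < T := by
    have : 0 < 12 * C / ε := by positivity
    exact pos_of_mul_pos_right (this.trans_le hT2) hb.le
  have hmain := sum_integral_regNorm₁_adamEMA_le (D := D) x₀ hF hS hlam.le hβ₀ hβ₁ hDpos T
  rw [← hΔ, hsqrt] at hmain
  -- Here `D² = (1-β)² ε / (16 d lam)`, so the variance term is free of `β`, `d` and `lam`.
  have hvar : lam * (d * D ^ 2) * (4 / (1 - β) ^ 2) = ε / 4 := by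
    rw [hD, div_pow, mul_pow, mul_pow, mul_pow, hsε2, hsd2, hsl2]
    field_simp
  -- This is the first entry of the maximum defining `T`, rearranged; the second entry gives
  -- `htail`.
  have hdec : Δ / D ≤ T * ε := by
    rw [div_le_iff₀ (by positivity)] at hT1
    rw [hD, div_div_eq_mul_div, div_le_iff₀ (by positivity)]
    nlinarith
  have hGle : l1Norm G ≤ l1Norm (fun i => G i + σ i) := by
    refine Finset.sum_le_sum fun i _ => ?_
    rw [abs_of_pos (hF.G_pos i), abs_of_pos (add_pos (hF.G_pos i) (hF.σ_pos i))]
    linarith [hF.σ_pos i]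
  set L := l1Norm (fun i => G i + σ i) with hL
  have hL0 : 0 ≤ L := l1Norm_nonneg _
  have htail : l1Norm G / (1 - β) ≤ T * (L * ε / (12 * C)) := by
    rw [div_le_iff₀ hb]
    have h1 : 1 ≤ ε / (12 * C) * ((1 - β) * T) := by
      have := mul_le_mul_of_nonneg_left hT2 (by positivity : 0 ≤ ε / (12 * C))
      have e : ε / (12 * C) * (12 * C / ε) = 1 := by field_simp
      linarith
    calc l1Norm G ≤ L * 1 := by rw [mul_one]; exact hGle
      _ ≤ L * (ε / (12 * C) * ((1 - β) * T)) := mul_le_mul_of_nonneg_left h1 hL0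
      _ = _ := by ring
  rw [hvar] at hmain
  rw [one_div_mul_eq_div, div_le_iff₀' hTpos]
  refine hmain.trans ?_
  have hLC : 0 ≤ L * ε / C := by positivity
  have e1 : 9 / 2 * (ε / (10 * C)) * L = 9 / 20 * (L * ε / C) := by field_simp; ring
  have e2 : L * ε / (12 * C) = 1 / 12 * (L * ε / C) := by field_simp
  have e3 : (2 + L / C) * ε = 2 * ε + L * ε / C := by ring
  rw [e1, e3]
  rw [e2] at htail
  -- Per unit of `T`, the `ε` coefficients add to `1/4 + 1 ≤ 2` and those of `L ε / C` to `9/20 +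
  -- 1/12 ≤ 1`.
  nlinarith [mul_nonneg hTpos.le hLC, mul_pos hTpos hε]
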